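/- Let $n\ge 1$ and let $K\subset\mathbb R^n$ be a convex body (compact, convex, with nonempty interior). Notation. For $L\subset\mathbb R^n$ put $h_L(x)=\sup\{\langle x,y\rangle:y\in L\}$ and $L^\circ=\{x:\langle x,y\rangle\le 1\text{ for all }y\in L\}$; $\chi_L$ is the characteristic function of $L$; $I^\infty_L$ equals $0$ on $L$ and $+\infty$ elsewhere; and $\|x\|_L=\inf\{t>0:x\in tL\}$, with $\inf\emptyset=+\infty$. For $\varphi:\mathbb R^n\to[-\infty,\infty]$ let $\varphi^*(x)=\sup_y(\langle x,y\rangle-\varphi(y))$. For $f=e^{-\varphi}:\mathbb R^n\to[0,\infty]$ let $h_f=\varphi^*$ be its support function and $f^\circ=e^{-h_f}$ its polar function. The projection body $\Pi K$ is the convex body with $h_{\Pi K}(u)=\mathrm{vol}_{n-1}(P_{u^\perp}K)$ for all unit vectors $u$, where $P_{u^\perp}$ is the orthogonal projection onto $u^\perp$, and $\Pi^\circ K=(\Pi K)^\circ$. The Petty projection function $\Pi f$ is the function with support function $$h_{\Pi f}(u)=\frac12\int_{\mathbb R^n}|\langle\nabla f(x),u\rangle|\,dx,\qquad u\in\mathbb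 R^n,$$ that is, $\Pi f=e^{-(h_{\Pi f})^*}$, and $\Pi^\circ f=(\Pi f)^\circ$. Here $\nabla f$ is the distributional gradient, so that the integral is the total mass $\sup\{\int f\,\langle\nabla\phi,u\rangle\,dx:\phi\in C^1_c(\mathbb R^n),\ |\phi|\le1\}$ of the derivative of $f$ in the direction $u$. Then: 1. $h_{\chi_K}=h_K$ and $h_{e^{-\|\cdot\|_K}}=I^\infty_{K^\circ}$. 2. $h_{\Pi\chi_K}=h_{\Pi K}$, $\ \Pi\chi_K=e^{-I^\infty_{\Pi K}}=\chi_{\Pi K}$, and $\Pi^\circ\chi_K=e^{-h_{\Pi K}}$. 3. $\mathrm{vol}(K)=\int_{\mathbb R^n}\chi_K(x)\,dx$ and $\int_{\mathbb R^n}\Pi^\circ\chi_K(x)\,dx=n!\,\mathrm{vol}(\Pi^\circ K)$. If moreover $0\in K$, then: 4. $h_{\Pi e^{-\|\cdot\|_K}}=(n-1)!\,h_{\Pi K}$; if $0$ is an interior point of $K$, then $e^{-\|\cdot\|_K}$ is differentiable almost everywhere and the same formula holds with the pointwise gradient in the definition of $h_{\Pi f}$. 5. $\int_{\mathbb R^n}e^{-\|x\|_K}\,dx=n!\,\mathrm{vol}(K)=n!\int_{\mathbb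 R^n}\chi_K(x)\,dx$. 6. $\int_{\mathbb R^n}\Pi^\circ(e^{-\|\cdot\|_K})(x)\,dx=n!\,\Gamma(n)^{-n}\,\mathrm{vol}(\Pi^\circ K)=\Gamma(n)^{-n}\int_{\mathbb R^n}\Pi^\circ\chi_K(x)\,dx$. -/

import Mathlib

open scoped ENNReal Pointwise RealInnerProductSpace
open MeasureTheory

noncomputable section

namespace Petty

/-- Euclidean `n`-space. -/
abbrev E (n : ℕ) : Type := EuclideanSpace ℝ (Fin n)

variable {n : ℕ}

/-- A convex body: a compact convex set with nonempty interior. -/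
structure IsConvexBody (K : Set (E n)) : Prop where
  convex : Convex ℝ K
  isCompact : IsCompact K
  nonempty_interior : (interior K).Nonempty

/-- The support function `h_K(x) = sup {⟪x, y⟫ : y ∈ K}` of a set. -/
def supportSet (K : Set (E n)) (x : E n) : EReal :=
  ⨆ y ∈ K, ((⟪x, y⟫ : ℝ) : EReal)

/-- The polar set `K° = {x : ⟪x, y⟫ ≤ 1 for all y ∈ K}`. -/
def polarSet (K : Set (E n)) : Set (E n) :=
  {x | ∀ y ∈ K, ⟪x, y⟫ ≤ 1}

/-- The convex indicator function `I^∞_K`: `0` on `K` and `∞` outside `K`. -/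
def indicatorInf (K : Set (E n)) (x : E n) : EReal :=
  open Classical in if x ∈ K then 0 else ⊤

/-- The characteristic function `χ_K`: `1` on `K` and `0` outside `K`. -/
def charFn (K : Set (E n)) : E n → ℝ≥0∞ :=
  K.indicator 1

/-- The gauge `‖x‖_K = inf {t > 0 : x ∈ t K}`; it is `∞` if there is no such `t`. -/
def gaugeInf (K : Set (E n)) (x : E n) : EReal :=
  ⨅ (t : ℝ) (_ : 0 < t) (_ : x ∈ t • K), (t : EReal)

/-- The function `e^{-φ}`, with `e^{-∞} = 0`. -/
def expNeg (φ : E n → EReal) (x : E n) : ℝ≥0∞ :=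
  EReal.exp (-φ x)

/-- The exponential gauge `e^{-‖·‖_K}`. -/
def expGauge (K : Set (E n)) : E n → ℝ≥0∞ :=
  expNeg (gaugeInf K)

/-- The Legendre transform `φ^*(x) = sup_y (⟪x, y⟫ - φ(y))`. -/
def legendre (φ : E n → EReal) (x : E n) : EReal :=
  ⨆ y : E n, ((⟪x, y⟫ : ℝ) : EReal) - φ y

/-- The support function `h_f = φ^*` of `f = e^{-φ}`, that is, of `φ = -log f` (`log 0 = -∞`). -/
def supportFn (f : E n → ℝ≥0∞) : E n → EReal :=
  legendre fun y => -ENNReal.log (f y)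

/-- The polar function `f° = e^{-φ^*} = e^{-h_f}` of `f = e^{-φ}`. -/
def polarFn (f : E n → ℝ≥0∞) : E n → ℝ≥0∞ :=
  expNeg (supportFn f)

/-- The `(n-1)`-dimensional volume `vol_{n-1}(P_{u^⊥} K)` of the orthogonal projection of `K` onto
the hyperplane `u^⊥` (for `u ≠ 0`). The measure is written out as the Lebesgue measure of the
Euclidean space `u^⊥`, normalized on an orthonormal basis, because `volume` on this subtype could
also be read as the restriction of the `n`-dimensional volume. -/
def projVol (K : Set (E n)) (u : E n) : ℝ≥0∞ :=
  (stdOrthonormalBasis ℝ ((ℝ ∙ u)ᗮ : Submodule ℝ (E n))).toBasis.addHaar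
    (((ℝ ∙ u)ᗮ : Submodule ℝ (E n)).orthogonalProjectionOnto '' K)

/-- The projection body `Π K`: the convex body with support function `vol_{n-1}(P_{u^⊥} K)` at
unit vectors `u`, written as the intersection of the half-spaces `⟪x, u⟫ ≤ vol_{n-1}(P_{u^⊥} K)`
(a convex body is the intersection of its supporting half-spaces). -/
def projBody (K : Set (E n)) : Set (E n) :=
  {x | ∀ u : E n, ‖u‖ = 1 → ((⟪x, u⟫ : ℝ) : EReal) ≤ (projVol K u : EReal)}

/-- The polar projection body `Π° K = (Π K)°`. -/
def polarProjBody (K : Set (E n)) : Set (E n) :=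
  polarSet (projBody K)

/-- The integral `∫ |⟪∇f, u⟫|`, with `∇f` in the sense of distributions (functions of bounded
variation): the total mass of the distributional derivative of `f` in the direction `u`,
`sup {∫ f ∂_u φ : φ ∈ C_c^1, |φ| ≤ 1}`. -/
def dirVariation (f : E n → ℝ≥0∞) (u : E n) : ℝ≥0∞ :=
  ⨆ (φ : E n → ℝ) (_ : ContDiff ℝ 1 φ) (_ : HasCompactSupport φ) (_ : ∀ x, |φ x| ≤ 1),
    ENNReal.ofReal (∫ x, (f x).toReal * fderiv ℝ φ x u)

/-- The prescribed support function `u ↦ (1/2) ∫ |⟪∇f, u⟫|` of the Petty projection function. -/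
def pettySupport (f : E n → ℝ≥0∞) (u : E n) : EReal :=
  ((dirVariation f u / 2 : ℝ≥0∞) : EReal)

/-- The same quantity `(1/2) ∫ |⟪∇f(x), u⟫| dx` with the pointwise gradient, for functions that
are differentiable almost everywhere. -/
def pettySupportPointwise (f : E n → ℝ≥0∞) (u : E n) : EReal :=
  (((∫⁻ x, ‖⟪gradient (fun z => (f z).toReal) x, u⟫‖ₑ) / 2 : ℝ≥0∞) : EReal)

/-- The Petty projection function `Π f = e^{-ψ}`, where `ψ` is the Legendre transform of the
prescribed support function. -/
def pettyFn (f : E n → ℝ≥0∞) : E n → ℝ≥0∞ :=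
  expNeg (legendre (pettySupport f))

/-- The polar projection function `Π° f = (Π f)°`. -/
def polarPettyFn (f : E n → ℝ≥0∞) : E n → ℝ≥0∞ :=
  polarFn (pettyFn f)

end Petty

end

namespace Petty

variable {n : ℕ}

/-! Everything rests on computing directional variations as limits of difference quotients. For
integrable `f`, the `L¹`-distance between `f` and its translate by `h u` is at most `h` times the
variation in direction `u` (`diffMass_le_dirVariation`), and the variation is at most the lower
limit of these distances divided by `h` (`dirVariation_le_liminf`).

For `χ_K`, Fubini over the lines parallel to a unit vector `u` reduces to intervals. An interval and
its translate by a small `h` differ by exactly `2h`, so the variation is `2 vol_{n-1}(P_{u^⊥} K)`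
(`dirVariation_charFn`). Half the variation is finite, sublinear and bounded below on the unit
sphere; by Hahn-Banach it is the support function of the convex body it defines, which is `Π K`
(`pettySupport_charFn`).

For `e^{-g}` with sublevel sets `{g ≤ t} = t A`, the layer cake formula `e^{-g(x)} = ∫_0^∞ e^{-t}
χ_A(x/t) dt` applies. Volume scales as `t^n`, which gives `∫ e^{-g} = n! vol(A)`; variation scales
as `t^(n-1)`, which gives the factor `(n-1)! = Γ(n)` (`IsGaugeOf.dirVariation_expNeg`). The volume
formula is used for `‖·‖_K`, where `A = K`, and for `h_L`, where `A = L°`.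

Finally, once the prescribed support function of `Π f` is `h_L` with `L` nonempty, closed and
convex, Legendre duality yields `Π f = χ_L` and `Π° f = e^{-h_L}`. The choices `L = Π K` and `L =
(n-1)! Π K` give the two cases, and polarity turns the dilation factor into `Γ(n)^{-n}`. -/

/-! ### Support functions, indicators and Legendre duality. -/

theorem supportSet_le_iff {L : Set (E n)} {x : E n} {c : EReal} :
    supportSet L x ≤ c ↔ ∀ y ∈ L, ((⟪x, y⟫ : ℝ) : EReal) ≤ c := by
  simp [supportSet]

theorem le_supportSet {L : Set (E n)} {x y : E n} (hy : y ∈ L) :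
    ((⟪x, y⟫ : ℝ) : EReal) ≤ supportSet L x :=
  le_iSup₂_of_le y hy le_rfl

theorem expNeg_indicatorInf (L : Set (E n)) : expNeg (indicatorInf L) = charFn L := by
  funext x
  by_cases hx : x ∈ L <;> simp [expNeg, indicatorInf, charFn, hx]

theorem supportFn_expNeg (φ : E n → EReal) : supportFn (expNeg φ) = legendre φ := by
  simp [supportFn, expNeg]

theorem legendre_indicatorInf (L : Set (E n)) : legendre (indicatorInf L) = supportSet L := by
  funext x
  refine le_antisymm (iSup_le fun y => ?_) (iSup₂_le fun y hy => le_iSup_of_le y ?_)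
  · by_cases hy : y ∈ L
    · simpa [indicatorInf, hy] using le_supportSet hy
    · simp [indicatorInf, hy]
  · simp [indicatorInf, hy]

theorem supportFn_charFn (L : Set (E n)) : supportFn (charFn L) = supportSet L := by
  rw [← expNeg_indicatorInf, supportFn_expNeg, legendre_indicatorInf]

theorem supportSet_smul_right (L : Set (E n)) {s : ℝ} (hs : 0 ≤ s) (x : E n) {c : ℝ}
    (h : ∀ y ∈ L, ⟪x, y⟫ ≤ c) : supportSet L (s • x) ≤ ((s * c : ℝ) : EReal) := by
  refine supportSet_le_iff.2 fun y hy => ?_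
  rw [real_inner_smul_left]
  exact_mod_cast mul_le_mul_of_nonneg_left (h y hy) hs

/-- Used for Legendre suprema outside the domain: along a ray the expression grows linearly with
slope at least `δ`. -/
theorem eq_top_of_forall_coe_mul_le {a : EReal} {δ : ℝ} (hδ : 0 < δ)
    (h : ∀ s : ℝ, 0 < s → ((s * δ : ℝ) : EReal) ≤ a) : a = ⊤ := by
  refine EReal.eq_top_iff_forall_lt a |>.2 fun r => ?_
  refine lt_of_lt_of_le ?_ (h ((|r| + 1) / δ) (by positivity))
  rw [div_mul_cancel₀ _ hδ.ne']
  exact_mod_cast (le_abs_self r).trans_lt (lt_add_one _)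

/-- The Legendre transform of the support function of a closed convex set is its indicator. -/
theorem legendre_supportSet {L : Set (E n)} (hne : L.Nonempty) (hconv : Convex ℝ L)
    (hcl : IsClosed L) : legendre (supportSet L) = indicatorInf L := by
  funext x
  by_cases hx : x ∈ L
  · rw [indicatorInf, if_pos hx]
    refine le_antisymm (iSup_le fun y => ?_) (le_iSup_of_le 0 ?_)
    · rw [EReal.sub_nonpos, real_inner_comm]
      exact le_supportSet hx
    · have : supportSet L 0 = 0 := by
        simp [supportSet, biSup_const hne]
      simp [this]
  · rw [indicatorInf, if_neg hx]
    obtain ⟨f, c, hf, hc⟩ := geometric_hahn_banach_closed_point hconv hcl hx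
    let u : E n := (InnerProductSpace.toDual ℝ (E n)).symm f
    have hu : ∀ y, ⟪u, y⟫ = f y := fun y => by
      simp [u]
    have hδ : 0 < f x - c := sub_pos.2 hc
    -- Along the ray spanned by the separating normal `u`, the expression `⟪x, s u⟫ - h_L(s u)` is
    -- at least `s (f x - c)`.
    refine eq_top_of_forall_coe_mul_le hδ fun s hs => le_iSup_of_le (s • u) ?_
    have h1 : supportSet L (s • u) ≤ ((s * c : ℝ) : EReal) :=
      supportSet_smul_right L hs.le u fun y hy => by rw [hu]; exact (hf y hy).le
    have h2 : ((⟪x, s • u⟫ : ℝ) : EReal) = ((s * f x : ℝ) : EReal) := by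
      rw [real_inner_smul_right, real_inner_comm, hu]
    rw [h2]
    refine le_trans (le_of_eq ?_) (EReal.sub_le_sub le_rfl h1)
    rw [← EReal.coe_sub, mul_sub]

/-- This reduces every claim about `Π f` and `Π° f` to recognizing `pettySupport f` as the support
function of a closed convex set. -/
theorem pettyFn_eq_charFn {f : E n → ℝ≥0∞} {L : Set (E n)} (hne : L.Nonempty)
    (hconv : Convex ℝ L) (hcl : IsClosed L) (h : pettySupport f = supportSet L) :
    pettyFn f = charFn L := by
  rw [pettyFn, h, legendre_supportSet hne hconv hcl, expNeg_indicatorInf]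

theorem supportFn_pettyFn {f : E n → ℝ≥0∞} {L : Set (E n)} (hne : L.Nonempty)
    (hconv : Convex ℝ L) (hcl : IsClosed L) (h : pettySupport f = supportSet L) :
    supportFn (pettyFn f) = supportSet L := by
  rw [pettyFn_eq_charFn hne hconv hcl h, supportFn_charFn]

theorem polarPettyFn_eq_expNeg {f : E n → ℝ≥0∞} {L : Set (E n)} (hne : L.Nonempty)
    (hconv : Convex ℝ L) (hcl : IsClosed L) (h : pettySupport f = supportSet L) :
    polarPettyFn f = expNeg (supportSet L) := by
  rw [polarPettyFn, polarFn, supportFn_pettyFn hne hconv hcl h]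

/-! ### Gauges, polar sets and dilations. -/

theorem gaugeInf_le {K : Set (E n)} {x : E n} {t : ℝ} (ht : 0 < t) (hx : x ∈ t • K) :
    gaugeInf K x ≤ (t : EReal) :=
  iInf_le_of_le t <| iInf_le_of_le ht <| iInf_le_of_le hx le_rfl

theorem le_gaugeInf_iff {K : Set (E n)} {x : E n} {c : EReal} :
    c ≤ gaugeInf K x ↔ ∀ t : ℝ, 0 < t → x ∈ t • K → c ≤ (t : EReal) := by
  simp [gaugeInf]

theorem gaugeInf_nonneg (K : Set (E n)) (x : E n) : 0 ≤ gaugeInf K x :=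
  le_gaugeInf_iff.2 fun _ ht _ => by exact_mod_cast ht.le

/-- The support function of the exponential gauge of a nonempty set is the indicator of the polar
set. -/
theorem supportFn_expGauge {K : Set (E n)} (hne : K.Nonempty) :
    supportFn (expGauge K) = indicatorInf (polarSet K) := by
  rw [expGauge, supportFn_expNeg]
  funext x
  by_cases hx : x ∈ polarSet K
  · rw [indicatorInf, if_pos hx]
    refine le_antisymm (iSup_le fun y => ?_) ?_
    · rw [EReal.sub_nonpos]
      refine le_gaugeInf_iff.2 fun t ht hy => ?_
      obtain ⟨k, hk, rfl⟩ := hy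
      simp only [real_inner_smul_right]
      exact_mod_cast mul_le_of_le_one_right ht.le (hx k hk)
    · obtain ⟨k, hk⟩ := hne
      refine EReal.ge_of_forall_gt_iff_ge.1 fun z hz => ?_
      have hz' : z < 0 := by exact_mod_cast hz
      have h1 : 0 ≤ 1 - ⟪x, k⟫ := sub_nonneg.2 (hx k hk)
      -- The gauge at `0` is infinite when `0 ∉ K`, so `y = 0` cannot serve as a witness; small
      -- multiples of a point of `K` approach the value `0` instead. The added `1` keeps the
      -- denominator positive when `⟪x, k⟫ = 1`.
      set s : ℝ := -z / (1 - ⟪x, k⟫ + 1) with hs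
      have hs0 : 0 < s := div_pos (neg_pos.2 hz') (by linarith)
      refine le_iSup_of_le (s • k) ?_
      refine le_trans ?_ (EReal.sub_le_sub le_rfl (gaugeInf_le hs0 (Set.smul_mem_smul_set hk)))
      rw [real_inner_smul_right, ← EReal.coe_sub, EReal.coe_le_coe_iff]
      have h2 : s * (1 - ⟪x, k⟫ + 1) = -z := div_mul_cancel₀ _ (by linarith)
      nlinarith
  · rw [indicatorInf, if_neg hx]
    simp only [polarSet, Set.mem_ofPred_eq, not_forall, not_le] at hx
    obtain ⟨k, hk, h1⟩ := hx
    refine eq_top_of_forall_coe_mul_le (sub_pos.2 h1) fun s hs => le_iSup_of_le (s • k) ?_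
    refine le_trans ?_ (EReal.sub_le_sub le_rfl (gaugeInf_le hs (Set.smul_mem_smul_set hk)))
    rw [real_inner_smul_right, ← EReal.coe_sub, mul_sub, mul_one]

/-- The sublevel sets of the gauge of a compact convex set that contains the origin. -/
theorem gaugeInf_le_iff {K : Set (E n)} (hconv : Convex ℝ K) (hcl : IsClosed K)
    (h0 : (0 : E n) ∈ K) {x : E n} {t : ℝ} (ht : 0 < t) :
    gaugeInf K x ≤ (t : EReal) ↔ t⁻¹ • x ∈ K := by
  refine ⟨fun h => ?_, fun h => gaugeInf_le ht ((Set.mem_smul_set_iff_inv_smul_mem₀ ht.ne' _ _).2 h)⟩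
  -- The infimum only supplies dilation factors below each `s > t`. Since `0 ∈ K`, membership passes
  -- up to `s`, and closedness allows `s ↓ t`.
  have key : ∀ s : ℝ, t < s → s⁻¹ • x ∈ K := fun s hs => by
    have h1 : gaugeInf K x < (s : EReal) := h.trans_lt (by exact_mod_cast hs)
    simp only [gaugeInf, iInf_lt_iff] at h1
    obtain ⟨r, hr, hxr, hrs⟩ := h1
    have hrs' : r < s := by exact_mod_cast hrs
    have hk := (Set.mem_smul_set_iff_inv_smul_mem₀ hr.ne' _ _).1 hxr
    have := hconv.smul_mem_of_zero_mem h0 hk (t := r / s)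
      ⟨div_nonneg hr.le (hr.trans hrs').le, (div_le_one (hr.trans hrs')).2 hrs'.le⟩
    rwa [smul_smul, div_mul_eq_mul_div, mul_inv_cancel₀ hr.ne', one_div] at this
  have hlim : Filter.Tendsto (fun s : ℝ => s⁻¹ • x) (nhdsWithin t (Set.Ioi t))
      (nhds (t⁻¹ • x)) :=
    (((continuousAt_inv₀ ht.ne').tendsto).mono_left nhdsWithin_le_nhds).smul_const x
  exact hcl.mem_of_tendsto hlim (Filter.eventually_of_mem self_mem_nhdsWithin key)

theorem supportSet_le_coe_iff {L : Set (E n)} {x : E n} {t : ℝ} (ht : 0 < t) :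
    supportSet L x ≤ (t : EReal) ↔ t⁻¹ • x ∈ polarSet L := by
  rw [supportSet_le_iff]
  refine forall₂_congr fun y _ => ?_
  rw [real_inner_smul_left, EReal.coe_le_coe_iff, inv_mul_le_iff₀ ht, mul_one]

theorem polarSet_isClosed (L : Set (E n)) : IsClosed (polarSet L) := by
  have : polarSet L = ⋂ y ∈ L, {x | ⟪x, y⟫ ≤ 1} := by ext; simp [polarSet]
  rw [this]
  exact isClosed_biInter fun y _ => isClosed_le (by fun_prop) continuous_const

theorem supportSet_smul_left {c : ℝ} (hc : 0 < c) (L : Set (E n)) (x : E n) :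
    supportSet (c • L) x = (c : EReal) * supportSet L x := by
  have key : ∀ y : E n, ((⟪x, c • y⟫ : ℝ) : EReal) = (c : EReal) * ((⟪x, y⟫ : ℝ) : EReal) := fun y => by
    rw [real_inner_smul_right, EReal.coe_mul]
  refine le_antisymm (supportSet_le_iff.2 ?_) ?_
  · rintro _ ⟨y, hy, rfl⟩
    rw [key]
    exact mul_le_mul_of_nonneg_left (le_supportSet hy) (by exact_mod_cast hc.le)
  · have h0 : (0 : EReal) < (c : EReal) := by exact_mod_cast hc
    rw [mul_comm, ← EReal.le_div_iff_mul_le h0 (EReal.coe_ne_top c)]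
    refine supportSet_le_iff.2 fun y hy => ?_
    rw [EReal.le_div_iff_mul_le h0 (EReal.coe_ne_top c), mul_comm, ← key]
    exact le_supportSet (Set.smul_mem_smul_set hy)

theorem polarSet_smul {c : ℝ} (hc : 0 < c) (L : Set (E n)) :
    polarSet (c • L) = c⁻¹ • polarSet L := by
  ext x
  rw [Set.mem_smul_set_iff_inv_smul_mem₀ (inv_ne_zero hc.ne'), inv_inv]
  simp only [polarSet, Set.mem_ofPred_eq]
  constructor
  · intro h y hy
    have := h (c • y) (Set.smul_mem_smul_set hy)
    rwa [real_inner_smul_right, ← real_inner_smul_left] at this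
  · rintro h _ ⟨y, hy, rfl⟩
    simp only [real_inner_smul_right, ← real_inner_smul_left]
    exact h y hy

/-! ### Layer cake formula and the integral of `e^{-g}`. -/

theorem lintegral_exp_neg_Ioi (r : ℝ) :
    ∫⁻ t in Set.Ioi r, ENNReal.ofReal (Real.exp (-t)) = ENNReal.ofReal (Real.exp (-r)) := by
  rw [← ofReal_integral_eq_lintegral_ofReal (integrableOn_exp_neg_Ioi r)
    (Filter.Eventually.of_forall fun t => (Real.exp_pos _).le), integral_exp_neg_Ioi]

theorem lintegral_exp_neg_mul_pow (k : ℕ) :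
    ∫⁻ t in Set.Ioi (0 : ℝ), ENNReal.ofReal (Real.exp (-t)) * ENNReal.ofReal (t ^ k) =
      (k.factorial : ℝ≥0∞) := by
  have h1 : ∀ t ∈ Set.Ioi (0 : ℝ), Real.exp (-t) * t ^ ((k : ℝ) + 1 - 1) = Real.exp (-t) * t ^ k :=
    fun t _ => by rw [add_sub_cancel_right, Real.rpow_natCast]
  have hint := (Real.GammaIntegral_convergent (s := (k : ℝ) + 1) (by positivity))
  rw [← ENNReal.ofReal_natCast, ← Real.Gamma_nat_eq_factorial,
    Real.Gamma_eq_integral (by positivity), setIntegral_congr_fun measurableSet_Ioi h1,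
    ofReal_integral_eq_lintegral_ofReal (hint.congr_fun h1 measurableSet_Ioi)]
  · simp only [ENNReal.ofReal_mul (Real.exp_pos _).le]
  · refine (ae_restrict_iff' measurableSet_Ioi).2 (Filter.Eventually.of_forall fun t ht => ?_)
    have : (0 : ℝ) < t := ht
    positivity

/-- `A` describes the sublevel sets of the nonnegative, positively homogeneous function `g`. -/
structure IsGaugeOf (A : Set (E n)) (g : E n → EReal) : Prop where
  measurableSet : MeasurableSet A
  nonneg : ∀ x, 0 ≤ g x
  le_iff : ∀ {x : E n} {t : ℝ}, 0 < t → (g x ≤ (t : EReal) ↔ t⁻¹ • x ∈ A)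

theorem measurable_smul_indicator {A : Set (E n)} (hA : MeasurableSet A) :
    Measurable fun p : E n × ℝ =>
      ENNReal.ofReal (Real.exp (-p.2)) * A.indicator (1 : E n → ℝ≥0∞) (p.2⁻¹ • p.1) := by
  refine Measurable.mul (by fun_prop) ?_
  exact (measurable_one.indicator hA).comp (by fun_prop)

/-- The layer cake representation of `e^{-g}`. -/
theorem IsGaugeOf.expNeg_eq {A : Set (E n)} {g : E n → EReal} (h : IsGaugeOf A g) (x : E n) :
    expNeg g x = ∫⁻ t in Set.Ioi (0 : ℝ), ENNReal.ofReal (Real.exp (-t)) *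
      A.indicator (1 : E n → ℝ≥0∞) (t⁻¹ • x) := by
  have h1 : ∀ t ∈ Set.Ioi (0 : ℝ), ENNReal.ofReal (Real.exp (-t)) *
      A.indicator (1 : E n → ℝ≥0∞) (t⁻¹ • x) =
      {t : ℝ | g x ≤ (t : EReal)}.indicator (fun t => ENNReal.ofReal (Real.exp (-t))) t := by
    intro t ht
    by_cases hx : g x ≤ (t : EReal)
    · simp [hx, (h.le_iff ht).1 hx]
    · have hx' : t⁻¹ • x ∉ A := fun hh => hx ((h.le_iff ht).2 hh)
      simp [hx, hx']
  have hm : MeasurableSet {t : ℝ | g x ≤ (t : EReal)} :=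
    measurableSet_le measurable_const measurable_coe_real_ereal
  rw [setLIntegral_congr_fun measurableSet_Ioi h1, lintegral_indicator hm,
    Measure.restrict_restrict hm, expNeg]
  have hx0 := h.nonneg x
  generalize g x = a at *
  induction a with
  | bot => simp at hx0
  | top => simp
  | coe r =>
    have hr : 0 ≤ r := by exact_mod_cast hx0
    have : ({t : ℝ | (r : EReal) ≤ (t : EReal)} ∩ Set.Ioi 0 : Set ℝ) =ᵐ[volume] Set.Ioi r := by
      have h2 : (Set.Ici r ∩ Set.Ioi 0 : Set ℝ) =ᵐ[volume] (Set.Ioi r ∩ Set.Ioi 0 : Set ℝ) :=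
        Ioi_ae_eq_Ici.symm.inter (ae_eq_refl _)
      rw [Set.Ioi_inter_Ioi, sup_eq_left.2 hr] at h2
      simpa [Set.Ici] using h2
    rw [Measure.restrict_congr_set this, lintegral_exp_neg_Ioi, ← EReal.coe_neg, EReal.exp_coe]

theorem IsGaugeOf.measurable_expNeg {A : Set (E n)} {g : E n → EReal} (h : IsGaugeOf A g) :
    Measurable (expNeg g) := by
  rw [show expNeg g = _ from funext h.expNeg_eq]
  exact (measurable_smul_indicator h.measurableSet).lintegral_prod_right'

theorem lintegral_comp_inv_smul {f : E n → ℝ≥0∞} (hf : Measurable f) {t : ℝ} (ht : 0 < t) :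
    ∫⁻ x, f (t⁻¹ • x) = ENNReal.ofReal (t ^ n) * ∫⁻ x, f x := by
  rw [← lintegral_map hf (by fun_prop), Measure.map_addHaar_smul volume (inv_ne_zero ht.ne'),
    lintegral_smul_measure, finrank_euclideanSpace_fin, smul_eq_mul]
  congr 2
  rw [inv_pow, inv_inv, abs_of_pos (pow_pos ht n)]

theorem IsGaugeOf.lintegral_expNeg {A : Set (E n)} {g : E n → EReal} (h : IsGaugeOf A g) :
    ∫⁻ x, expNeg g x = (n.factorial : ℝ≥0∞) * volume A := by
  simp only [h.expNeg_eq]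
  rw [lintegral_lintegral_swap (measurable_smul_indicator h.measurableSet).aemeasurable]
  have h1 : ∀ t ∈ Set.Ioi (0 : ℝ), (∫⁻ x : E n, ENNReal.ofReal (Real.exp (-t)) *
      A.indicator (1 : E n → ℝ≥0∞) (t⁻¹ • x)) =
      ENNReal.ofReal (Real.exp (-t)) * ENNReal.ofReal (t ^ n) * volume A := by
    intro t ht
    have hm : Measurable fun x : E n => A.indicator (1 : E n → ℝ≥0∞) (t⁻¹ • x) :=
      (measurable_one.indicator h.measurableSet).comp (measurable_const_smul t⁻¹)
    rw [lintegral_const_mul _ hm,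
      lintegral_comp_inv_smul (measurable_one.indicator h.measurableSet) ht,
      lintegral_indicator_one h.measurableSet, mul_assoc]
  rw [setLIntegral_congr_fun measurableSet_Ioi h1, lintegral_mul_const _ (by fun_prop),
    lintegral_exp_neg_mul_pow]

theorem isGaugeOf_gaugeInf {K : Set (E n)} (hconv : Convex ℝ K) (hcl : IsClosed K)
    (h0 : (0 : E n) ∈ K) : IsGaugeOf K (gaugeInf K) :=
  ⟨hcl.measurableSet, gaugeInf_nonneg K, fun ht => gaugeInf_le_iff hconv hcl h0 ht⟩

/-- A support function is the gauge of the polar set, so the volume formula for gauges also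
integrates `e^{-h_L}`. The hypothesis `0 ∈ L` makes `h_L` nonnegative. -/
theorem isGaugeOf_supportSet {L : Set (E n)} (h0 : (0 : E n) ∈ L) :
    IsGaugeOf (polarSet L) (supportSet L) :=
  ⟨(polarSet_isClosed L).measurableSet, fun x => by simpa using le_supportSet (x := x) h0,
    fun ht => supportSet_le_coe_iff ht⟩

theorem expNeg_le_one {g : E n → EReal} (hg : ∀ x, 0 ≤ g x) (x : E n) : expNeg g x ≤ 1 := by
  rw [expNeg, EReal.exp_le_one_iff, EReal.neg_le_zero]
  exact hg x

/-! ### Directional variation through difference quotients. -/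

/-- The `L¹`-distance between `F` and its translate by `v`. -/
noncomputable def diffMass (F : E n → ℝ) (v : E n) : ℝ≥0∞ :=
  ∫⁻ x, ‖F (x + v) - F x‖ₑ

open Filter Topology in
/-- The `L¹`-norm is the supremum of the integrals against test functions. -/
theorem lintegral_enorm_le_of_forall_test {G : E n → ℝ} (hG : Integrable G) {B : ℝ≥0∞}
    (h : ∀ ψ : E n → ℝ, ContDiff ℝ 1 ψ → HasCompactSupport ψ → (∀ x, |ψ x| ≤ 1) →
      ENNReal.ofReal (∫ x, G x * ψ x) ≤ B) : ∫⁻ x, ‖G x‖ₑ ≤ B := by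
  -- The sign of `G`; division by zero gives `0`, so `|σ| ≤ 1` everywhere. The test functions are
  -- mollifications of `σ` times cutoffs `η k`.
  let σ : E n → ℝ := fun x => G x / |G x|
  have hσm : AEStronglyMeasurable σ volume :=
    (hG.aemeasurable.div hG.aemeasurable.norm).aestronglyMeasurable
  have hσ1 : ∀ x, |σ x| ≤ 1 := fun x => by
    simp only [σ, abs_div, abs_abs]; exact div_self_le_one _
  have hσl : LocallyIntegrable σ volume := by
    refine (locallyIntegrable_const (1 : ℝ)).mono hσm (Eventually.of_forall fun x => ?_)
    simpa using hσ1 x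
  let b : ℕ → ContDiffBump (0 : E n) := fun k =>
    ⟨1 / ((k : ℝ) + 1), 2 / ((k : ℝ) + 1), by positivity, by gcongr; norm_num⟩
  let η : ℕ → ContDiffBump (0 : E n) := fun k => ⟨(k : ℝ) + 1, (k : ℝ) + 2, by positivity, by linarith⟩
  have hb : ∀ k, (b k).rOut = 2 / ((k : ℝ) + 1) := fun k => rfl
  have hb' : ∀ k, (b k).rIn = 1 / ((k : ℝ) + 1) := fun k => rfl
  -- The outer radius is twice the inner one, whence `K = 2`. The bounded ratio gives almost
  -- everywhere convergence for a merely locally integrable `σ`.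
  have hconv := ContDiffBump.ae_convolution_tendsto_right_of_locallyIntegrable (μ := volume)
    (φ := b) (l := atTop) (K := 2) (g := σ)
    (by simpa [hb, div_eq_mul_inv] using
          (tendsto_one_div_add_atTop_nhds_zero_nat (𝕜 := ℝ)).const_mul 2)
    (Eventually.of_forall fun k => by rw [hb, hb']; ring_nf; rfl) hσl
  let S : ℕ → E n → ℝ := fun k =>
    convolution ((b k).normed volume) σ (ContinuousLinearMap.lsmul ℝ ℝ) volume
  have hS1 : ∀ k x, |S k x| ≤ 1 := fun k x => by
    have := dist_convolution_le (μ := volume) (x₀ := x) (g := σ) (z₀ := (0 : ℝ)) zero_le_one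
      (b k).support_normed_eq.subset (b k).nonneg_normed (b k).integral_normed hσm
      (fun y _ => by simpa using hσ1 y)
    simpa [S] using this
  let ψ : ℕ → E n → ℝ := fun k x => η k x * S k x
  have hψc : ∀ k, ContDiff ℝ 1 (ψ k) := fun k =>
    (η k).contDiff.mul
      (((b k).hasCompactSupport_normed).contDiff_convolution_left _ (b k).contDiff_normed hσl)
  have hψs : ∀ k, HasCompactSupport (ψ k) := fun k => (η k).hasCompactSupport.mul_right
  have hψ1 : ∀ k x, |ψ k x| ≤ 1 := fun k x => by
    simp only [ψ, abs_mul]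
    exact mul_le_one₀ (by rw [abs_of_nonneg (η k).nonneg]; exact (η k).le_one) (abs_nonneg _) (hS1 k x)
  have hη : ∀ x, ∀ᶠ k in atTop, η k x = 1 := fun x => by
    obtain ⟨N, hN⟩ := exists_nat_ge ‖x‖
    filter_upwards [eventually_ge_atTop N] with k hk
    refine (η k).one_of_mem_closedBall ?_
    have : (N : ℝ) ≤ k := by exact_mod_cast hk
    simp only [mem_closedBall_zero_iff, η]
    linarith
  have hψt : ∀ᵐ x, Tendsto (fun k => ψ k x) atTop (𝓝 (σ x)) := by
    filter_upwards [hconv] with x hx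
    refine hx.congr' ?_
    filter_upwards [hη x] with k hk
    simp [ψ, S, hk]
  have hlim : Tendsto (fun k => ∫ x, G x * ψ k x) atTop (𝓝 (∫ x, G x * σ x)) := by
    refine tendsto_integral_of_dominated_convergence (fun x => |G x|)
      (fun k => hG.aestronglyMeasurable.mul (hψc k).continuous.aestronglyMeasurable) hG.abs
      (fun k => Eventually.of_forall fun x => ?_) ?_
    · rw [Real.norm_eq_abs, abs_mul]
      exact mul_le_of_le_one_right (abs_nonneg _) (hψ1 k x)
    · filter_upwards [hψt] with x hx using hx.const_mul _
  have hGσ : (fun x => G x * σ x) = fun x => |G x| := by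
    funext x
    simp only [σ]
    rcases eq_or_ne (G x) 0 with h0 | h0
    · simp [h0]
    · rw [← mul_div_assoc, ← abs_mul_abs_self, mul_div_assoc, div_self (abs_ne_zero.2 h0), mul_one]
  rw [hGσ] at hlim
  have h2 := le_of_tendsto' ((ENNReal.continuous_ofReal.tendsto _).comp hlim)
    fun k => h (ψ k) (hψc k) (hψs k) (hψ1 k)
  rwa [ofReal_integral_eq_lintegral_ofReal hG.abs (Eventually.of_forall fun x => abs_nonneg _),
    lintegral_congr fun x => (Real.enorm_eq_ofReal_abs (G x)).symm] at h2

/-- Discrete integration by parts: translation invariance moves the difference from the test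
function to `F`. -/
theorem integral_mul_sub_translate {F ψ : E n → ℝ} (hF : Integrable F) (hψ : Continuous ψ)
    (hψ1 : ∀ x, |ψ x| ≤ 1) (v : E n) :
    ∫ x, F x * (ψ x - ψ (x - v)) = ∫ x, (F x - F (x + v)) * ψ x := by
  have h1 : Integrable fun x => F x * ψ x :=
    hF.mul_bdd (c := 1) hψ.aestronglyMeasurable (Filter.Eventually.of_forall hψ1)
  have h2 : Integrable fun x => F x * ψ (x - v) :=
    hF.mul_bdd (c := 1) (by fun_prop : Continuous fun x => ψ (x - v)).aestronglyMeasurable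
      (Filter.Eventually.of_forall fun x => hψ1 _)
  have h3 : Integrable fun x => F (x + v) * ψ x :=
    (hF.comp_add_right v).mul_bdd (c := 1) hψ.aestronglyMeasurable (Filter.Eventually.of_forall hψ1)
  simp only [mul_sub, sub_mul]
  rw [integral_sub h1 h2, integral_sub h1 h3]
  congr 1
  rw [← integral_add_right_eq_self _ v]
  simp

theorem le_dirVariation (f : E n → ℝ≥0∞) (u : E n) {φ : E n → ℝ} (h1 : ContDiff ℝ 1 φ)
    (h2 : HasCompactSupport φ) (h3 : ∀ x, |φ x| ≤ 1) :
    ENNReal.ofReal (∫ x, (f x).toReal * fderiv ℝ φ x u) ≤ dirVariation f u :=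
  le_iSup_of_le φ <| le_iSup_of_le h1 <| le_iSup_of_le h2 <| le_iSup_of_le h3 le_rfl

theorem dirVariation_le_iff {f : E n → ℝ≥0∞} {u : E n} {B : ℝ≥0∞} :
    dirVariation f u ≤ B ↔ ∀ φ : E n → ℝ, ContDiff ℝ 1 φ → HasCompactSupport φ →
      (∀ x, |φ x| ≤ 1) → ENNReal.ofReal (∫ x, (f x).toReal * fderiv ℝ φ x u) ≤ B := by
  simp [dirVariation]

theorem continuous_fderiv_apply_const {φ : E n → ℝ} (h1 : ContDiff ℝ 1 φ) (u : E n) :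
    Continuous fun x => fderiv ℝ φ x u :=
  (h1.continuous_fderiv one_ne_zero).clm_apply continuous_const

theorem exists_fderiv_bound {φ : E n → ℝ} (h1 : ContDiff ℝ 1 φ) (h2 : HasCompactSupport φ)
    (u : E n) : ∃ C, ∀ x, ‖fderiv ℝ φ x u‖ ≤ C :=
  (h2.fderiv_apply (𝕜 := ℝ) u).exists_bound_of_continuous (continuous_fderiv_apply_const h1 u)

/-- Difference quotients are bounded by the directional variation. -/
theorem diffMass_le_dirVariation {f : E n → ℝ≥0∞} (hF : Integrable fun x => (f x).toReal)
    (u : E n) {h : ℝ} (hh : 0 < h) :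
    diffMass (fun x => (f x).toReal) (h • u) ≤ ENNReal.ofReal h * dirVariation f u := by
  rcases eq_or_ne (dirVariation f u) ⊤ with htop | htop
  · rw [htop, ENNReal.mul_top (by simpa using hh)]; exact le_top
  set F : E n → ℝ := fun x => (f x).toReal with hFdef
  have h0 : diffMass F (h • u) = ∫⁻ x, ‖F x - F (x + h • u)‖ₑ := by
    refine lintegral_congr fun x => ?_
    rw [← enorm_neg, neg_sub]
  rw [h0]
  refine lintegral_enorm_le_of_forall_test (hF.sub (hF.comp_add_right (h • u))) fun ψ h1 h2 h3 => ?_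
  simp only [Pi.sub_apply]
  rw [← integral_mul_sub_translate hF h1.continuous h3]
  -- The difference of `ψ` is an average of directional derivatives of its translates. Each
  -- translate is again admissible in the supremum, so every slice contributes at most the
  -- variation.
  have hftc : ∀ x, ψ x - ψ (x - h • u) = ∫ s in Set.Ioc 0 h, fderiv ℝ ψ (x - s • u) u := by
    intro x
    have hd : ∀ s ∈ Set.uIcc 0 h, HasDerivAt (fun s : ℝ => -ψ (x - s • u))
        (fderiv ℝ ψ (x - s • u) u) s := by
      intro s _
      have e1 : HasDerivAt (fun s : ℝ => x - s • u) (-u) s := by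
        simpa using ((hasDerivAt_id s).smul_const u).const_sub x
      have e2 := ((h1.differentiable one_ne_zero (x - s • u)).hasFDerivAt.comp_hasDerivAt s e1).neg
      simpa [Function.comp_def] using! e2
    have hc : Continuous fun s : ℝ => fderiv ℝ ψ (x - s • u) u :=
      (continuous_fderiv_apply_const h1 u).comp (by fun_prop)
    have := intervalIntegral.integral_eq_sub_of_hasDerivAt hd (hc.intervalIntegrable _ _)
    rw [intervalIntegral.integral_of_le hh.le] at this
    rw [this]; simp; ring
  obtain ⟨C, hC⟩ := exists_fderiv_bound h1 h2 u
  have hint : Integrable (fun p : E n × ℝ => F p.1 * fderiv ℝ ψ (p.1 - p.2 • u) u)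
      (volume.prod (volume.restrict (Set.Ioc 0 h))) := by
    refine (hF.comp_fst _).mul_bdd (c := C) ?_ (Filter.Eventually.of_forall fun p => hC _)
    exact ((continuous_fderiv_apply_const h1 u).comp (by fun_prop)).aestronglyMeasurable
  have hswap : ∫ x, F x * (ψ x - ψ (x - h • u)) =
      ∫ s in Set.Ioc 0 h, ∫ x, F x * fderiv ℝ ψ (x - s • u) u := by
    rw [← integral_integral_swap hint]
    refine integral_congr_ae (Filter.Eventually.of_forall fun x => ?_)
    simp only [hftc x, integral_const_mul]
  have hs : ∀ s : ℝ, ∫ x, F x * fderiv ℝ ψ (x - s • u) u ≤ (dirVariation f u).toReal := by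
    intro s
    have e1 : ContDiff ℝ 1 fun x => ψ (x - s • u) := h1.comp (contDiff_id.sub contDiff_const)
    have e2 : HasCompactSupport fun x => ψ (x - s • u) := by
      simpa [sub_eq_add_neg, Function.comp_def] using h2.comp_homeomorph (Homeomorph.addRight (-(s • u)))
    have e3 := le_dirVariation f u e1 e2 fun x => h3 _
    simp only [fderiv_comp_sub] at e3
    exact (ENNReal.ofReal_le_iff_le_toReal htop).1 e3
  rw [hswap, ← ENNReal.ofReal_toReal htop, ← ENNReal.ofReal_mul hh.le]
  refine ENNReal.ofReal_le_ofReal ?_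
  refine (integral_mono hint.integral_prod_right (integrable_const _) hs).trans ?_
  simp [hh.le]

open Filter Topology in
/-- The directional variation is bounded by difference quotients with small steps. -/
theorem dirVariation_le_liminf {f : E n → ℝ≥0∞} (hF : Integrable fun x => (f x).toReal)
    (u : E n) {h : ℕ → ℝ} (hpos : ∀ k, 0 < h k) (hlim : Tendsto h atTop (𝓝 0)) :
    dirVariation f u ≤ liminf (fun k =>
      diffMass (fun x => (f x).toReal) (h k • u) / ENNReal.ofReal (h k)) atTop := by
  set F : E n → ℝ := fun x => (f x).toReal with hFdef
  refine dirVariation_le_iff.2 fun φ h1 h2 h3 => ?_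
  obtain ⟨C, hC⟩ := h1.lipschitzWith_of_hasCompactSupport h2 one_ne_zero
  have hc := h1.continuous
  have hlim2 : Tendsto (fun k => ∫ x, F x * ((h k)⁻¹ * (φ x - φ (x - h k • u)))) atTop
      (𝓝 (∫ x, F x * fderiv ℝ φ x u)) := by
    refine tendsto_integral_of_dominated_convergence (fun x => |F x| * (C * ‖u‖))
      (fun k => hF.aestronglyMeasurable.mul
        (by fun_prop : Continuous fun x => (h k)⁻¹ * (φ x - φ (x - h k • u))).aestronglyMeasurable)
      (hF.abs.mul_const _) (fun k => Eventually.of_forall fun x => ?_)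
      (Eventually.of_forall fun x => ?_)
    · rw [Real.norm_eq_abs, abs_mul]
      refine mul_le_mul_of_nonneg_left ?_ (abs_nonneg _)
      have := hC.dist_le_mul x (x - h k • u)
      rw [Real.dist_eq, dist_eq_norm, sub_sub_cancel, norm_smul, Real.norm_of_nonneg (hpos k).le]
        at this
      rw [abs_mul, abs_of_pos (inv_pos.2 (hpos k)), inv_mul_le_iff₀ (hpos k)]
      linarith
    · refine Tendsto.const_mul _ ?_
      have hd : HasDerivAt (fun s : ℝ => φ (x - s • u)) (-fderiv ℝ φ x u) 0 := by
        have e1 : HasDerivAt (fun s : ℝ => x - s • u) (-u) 0 := by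
          simpa using ((hasDerivAt_id (0 : ℝ)).smul_const u).const_sub x
        have e0 : DifferentiableAt ℝ φ (x - (0 : ℝ) • u) := h1.differentiable one_ne_zero _
        simpa [Function.comp_def] using! e0.hasFDerivAt.comp_hasDerivAt (0 : ℝ) e1
      have e3 := (hasDerivAt_iff_tendsto_slope_zero.1 hd).comp
        (tendsto_nhdsWithin_iff.2 ⟨hlim, Eventually.of_forall fun k => (hpos k).ne'⟩)
      have e4 := e3.neg
      rw [neg_neg] at e4
      refine e4.congr fun k => ?_
      simp only [Function.comp_apply, zero_add, zero_smul, sub_zero, smul_eq_mul]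
      ring
  have hle : ∀ k, ENNReal.ofReal (∫ x, F x * ((h k)⁻¹ * (φ x - φ (x - h k • u)))) ≤
      diffMass F (h k • u) / ENNReal.ofReal (h k) := by
    intro k
    have e1 : ∫ x, F x * ((h k)⁻¹ * (φ x - φ (x - h k • u))) =
        (h k)⁻¹ * ∫ x, (F x - F (x + h k • u)) * φ x := by
      rw [← integral_mul_sub_translate hF hc h3, ← integral_const_mul]
      congr 1; funext x; ring
    rw [e1, ENNReal.ofReal_mul (inv_pos.2 (hpos k)).le, ENNReal.ofReal_inv_of_pos (hpos k),
      mul_comm, ← div_eq_mul_inv]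
    refine ENNReal.div_le_div_right ?_ _
    refine (ENNReal.ofReal_le_ofReal (le_abs_self _)).trans ?_
    rw [← Real.enorm_eq_ofReal_abs]
    refine (enorm_integral_le_lintegral_enorm _).trans (lintegral_mono fun x => ?_)
    rw [enorm_mul, ← enorm_neg, neg_sub]
    refine mul_le_of_le_one_right' ?_
    rw [Real.enorm_eq_ofReal_abs]
    exact ENNReal.ofReal_le_one.2 (h3 x)
  have := ((ENNReal.continuous_ofReal.tendsto _).comp hlim2).liminf_eq
  rw [← this]
  exact liminf_le_liminf (Eventually.of_forall hle)

theorem liminf_atTop_le_of_forall_le {a : ℕ → ℝ≥0∞} {B : ℝ≥0∞} (h : ∀ k, a k ≤ B) :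
    Filter.liminf a Filter.atTop ≤ B := by
  refine Filter.liminf_le_of_le (by isBoundedDefault) fun b hb => ?_
  obtain ⟨k, hk⟩ := hb.exists
  exact hk.trans (h k)

/-- The directional variation is at most any uniform bound of the difference quotients. -/
theorem dirVariation_le_of_diffMass_le {f : E n → ℝ≥0∞} (hF : Integrable fun x => (f x).toReal)
    (u : E n) {B : ℝ≥0∞}
    (hB : ∀ h : ℝ, 0 < h → diffMass (fun x => (f x).toReal) (h • u) ≤ ENNReal.ofReal h * B) :
    dirVariation f u ≤ B := by
  refine (dirVariation_le_liminf hF u (h := fun k => 1 / ((k : ℝ) + 1)) (fun k => by positivity)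
    tendsto_one_div_add_atTop_nhds_zero_nat).trans ?_
  refine liminf_atTop_le_of_forall_le fun k => ENNReal.div_le_of_le_mul ?_
  rw [mul_comm]
  exact hB _ (by positivity)

/-! ### Variation of the exponential of a gauge. -/

theorem enorm_toReal_sub_toReal {a b : ℝ≥0∞} (ha : a ≠ ⊤) (hab : b ≤ a) :
    ‖a.toReal - b.toReal‖ₑ = a - b := by
  rw [← ENNReal.toReal_sub_of_le hab ha, Real.enorm_eq_ofReal ENNReal.toReal_nonneg,
    ENNReal.ofReal_toReal (ENNReal.sub_ne_top ha)]

theorem measurable_charFn {A : Set (E n)} (hA : MeasurableSet A) : Measurable (charFn A) :=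
  measurable_one.indicator hA

theorem charFn_ne_top (A : Set (E n)) (x : E n) : charFn A x ≠ ⊤ := by
  by_cases hx : x ∈ A <;> simp [charFn, hx]

theorem integrable_charFn {A : Set (E n)} (hA : MeasurableSet A) (hv : volume A ≠ ⊤) :
    Integrable fun x => (charFn A x).toReal := by
  refine integrable_toReal_of_lintegral_ne_top (measurable_charFn hA).aemeasurable ?_
  rwa [charFn, lintegral_indicator_one hA]

theorem IsGaugeOf.integrable_expNeg {A : Set (E n)} {g : E n → EReal} (h : IsGaugeOf A g)
    (hv : volume A ≠ ⊤) : Integrable fun x => (expNeg g x).toReal := by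
  refine integrable_toReal_of_lintegral_ne_top h.measurable_expNeg.aemeasurable ?_
  rw [h.lintegral_expNeg]
  exact ENNReal.mul_ne_top (ENNReal.natCast_ne_top _) hv

theorem measurable_charFn_smul {A : Set (E n)} (hA : MeasurableSet A) (x : E n) :
    Measurable fun t : ℝ => charFn A (t⁻¹ • x) :=
  (measurable_charFn hA).comp (by fun_prop)

/-- The differences of `e^{-g}` are integrals of the differences of its superlevel sets. -/
theorem IsGaugeOf.enorm_sub_eq {A : Set (E n)} {g : E n → EReal} (h : IsGaugeOf A g)
    (x y : E n) :
    ‖(expNeg g y).toReal - (expNeg g x).toReal‖ₑ =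
      ∫⁻ t in Set.Ioi (0 : ℝ), ENNReal.ofReal (Real.exp (-t)) *
        ‖(charFn A (t⁻¹ • y)).toReal - (charFn A (t⁻¹ • x)).toReal‖ₑ := by
  wlog hxy : g y ≤ g x generalizing x y with H
  · have := H y x (not_le.1 hxy).le
    rw [← enorm_neg, neg_sub, this]
    refine lintegral_congr fun t => ?_
    rw [← enorm_neg, neg_sub]
  have hne : ∀ z, expNeg g z ≠ ⊤ := fun z => ((expNeg_le_one h.nonneg z).trans_lt (by simp)).ne
  have hle : expNeg g x ≤ expNeg g y :=
    EReal.exp_le_exp_iff.2 (EReal.neg_le_neg_iff.2 hxy)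
  -- The sublevel sets are nested, so all layers are ordered in the same way and the absolute value
  -- commutes with the integral over `t`.
  have hχ : ∀ t ∈ Set.Ioi (0 : ℝ), charFn A (t⁻¹ • x) ≤ charFn A (t⁻¹ • y) := by
    intro t ht
    by_cases hx : t⁻¹ • x ∈ A
    · have hy : t⁻¹ • y ∈ A := (h.le_iff ht).1 (hxy.trans ((h.le_iff ht).2 hx))
      simp [charFn, hx, hy]
    · simp [charFn, hx]
  have e : ∀ t ∈ Set.Ioi (0 : ℝ), ENNReal.ofReal (Real.exp (-t)) *
        ‖(charFn A (t⁻¹ • y)).toReal - (charFn A (t⁻¹ • x)).toReal‖ₑ =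
        ENNReal.ofReal (Real.exp (-t)) * charFn A (t⁻¹ • y) -
        ENNReal.ofReal (Real.exp (-t)) * charFn A (t⁻¹ • x) := fun t ht => by
    rw [enorm_toReal_sub_toReal (charFn_ne_top _ _) (hχ t ht),
      ENNReal.mul_sub fun _ _ => ENNReal.ofReal_ne_top]
  rw [enorm_toReal_sub_toReal (hne y) hle, setLIntegral_congr_fun measurableSet_Ioi e,
    lintegral_sub]
  · rw [h.expNeg_eq y, h.expNeg_eq x]; rfl
  · exact Measurable.mul (by fun_prop) (measurable_charFn_smul h.measurableSet x)
  · have := h.expNeg_eq x ▸ hne x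
    exact this
  · refine (ae_restrict_iff' measurableSet_Ioi).2 (Filter.Eventually.of_forall fun t ht => ?_)
    exact mul_le_mul_right (hχ t ht) _

theorem measurable_diffMass {F : E n → ℝ} (hF : Measurable F) : Measurable (diffMass F) := by
  have : Measurable fun p : E n × E n => ‖F (p.2 + p.1) - F p.2‖ₑ := by fun_prop
  exact this.lintegral_prod_right'

theorem IsGaugeOf.diffMass_eq {A : Set (E n)} {g : E n → EReal} (h : IsGaugeOf A g) (v : E n) :
    diffMass (fun x => (expNeg g x).toReal) v =
      ∫⁻ t in Set.Ioi (0 : ℝ), ENNReal.ofReal (Real.exp (-t)) *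
        (ENNReal.ofReal (t ^ n) * diffMass (fun x => (charFn A x).toReal) (t⁻¹ • v)) := by
  have hm : Measurable fun x => (charFn A x).toReal := (measurable_charFn h.measurableSet).ennreal_toReal
  have hmp : Measurable fun p : E n × ℝ => ENNReal.ofReal (Real.exp (-p.2)) *
      ‖(charFn A (p.2⁻¹ • (p.1 + v))).toReal - (charFn A (p.2⁻¹ • p.1)).toReal‖ₑ := by
    refine Measurable.mul (by fun_prop) (Measurable.enorm (Measurable.sub ?_ ?_))
    · exact hm.comp (by fun_prop : Measurable fun p : E n × ℝ => p.2⁻¹ • (p.1 + v))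
    · exact hm.comp (by fun_prop : Measurable fun p : E n × ℝ => p.2⁻¹ • p.1)
  rw [diffMass]
  simp only [h.enorm_sub_eq]
  rw [lintegral_lintegral_swap hmp.aemeasurable]
  refine setLIntegral_congr_fun measurableSet_Ioi fun t ht => ?_
  have hm2 : Measurable fun x => ‖(charFn A (x + t⁻¹ • v)).toReal - (charFn A x).toReal‖ₑ :=
    ((hm.comp (measurable_add_const (t⁻¹ • v))).sub hm).enorm
  have hm3 : Measurable fun x =>
      ‖(charFn A (t⁻¹ • (x + v))).toReal - (charFn A (t⁻¹ • x)).toReal‖ₑ :=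
    ((hm.comp (by fun_prop : Measurable fun x : E n => t⁻¹ • (x + v))).sub
      (hm.comp (measurable_const_smul t⁻¹))).enorm
  rw [lintegral_const_mul _ hm3, diffMass, ← lintegral_comp_inv_smul hm2 ht]
  simp only [smul_add]

open Filter Topology in
/-- The variation of the exponential of a gauge in terms of the variation of its unit ball. -/
theorem IsGaugeOf.dirVariation_expNeg (hn : 1 ≤ n) {A : Set (E n)} {g : E n → EReal}
    (h : IsGaugeOf A g) (hv : volume A ≠ ⊤) (u : E n) :
    dirVariation (expNeg g) u = ((n - 1).factorial : ℝ≥0∞) * dirVariation (charFn A) u := by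
  obtain ⟨m, rfl⟩ : ∃ m, n = m + 1 := ⟨n - 1, by omega⟩
  rw [Nat.add_sub_cancel]
  have hF := h.integrable_expNeg hv
  have hχ := integrable_charFn h.measurableSet hv
  have hm : Measurable fun x => (charFn A x).toReal := (measurable_charFn h.measurableSet).ennreal_toReal
  have hconst : ∫⁻ t in Set.Ioi (0 : ℝ), ENNReal.ofReal (Real.exp (-t)) * ENNReal.ofReal (t ^ m) *
      dirVariation (charFn A) u = (m.factorial : ℝ≥0∞) * dirVariation (charFn A) u := by
    rw [lintegral_mul_const _ (by fun_prop), lintegral_exp_neg_mul_pow]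
  refine le_antisymm (dirVariation_le_of_diffMass_le hF u fun s hs => ?_) ?_
  · rw [h.diffMass_eq, ← hconst, ← lintegral_const_mul' _ _ ENNReal.ofReal_ne_top]
    refine setLIntegral_mono_ae' measurableSet_Ioi (Eventually.of_forall fun t ht => ?_)
    have ht' : (0 : ℝ) < t := ht
    -- Rescaling by `t` turns the step `s` into `s / t`, which lowers the volume factor `t ^ (m +
    -- 1)` to `t ^ m`; hence `m!` instead of `(m + 1)!`.
    have h1 := diffMass_le_dirVariation hχ u (mul_pos (inv_pos.2 ht') hs)
    rw [smul_smul]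
    refine (mul_le_mul_right (mul_le_mul_right h1 _) _).trans (le_of_eq ?_)
    have h2 : ENNReal.ofReal (t ^ (m + 1)) * ENNReal.ofReal (t⁻¹ * s) =
        ENNReal.ofReal s * ENNReal.ofReal (t ^ m) := by
      rw [← ENNReal.ofReal_mul (by positivity), ← ENNReal.ofReal_mul hs.le]
      congr 1
      field_simp
      ring
    rw [← mul_assoc (ENNReal.ofReal (t ^ (m + 1))), h2]
    ring
  -- Conversely, for each fixed `t` the steps `s k / t` tend to `0`, so the quotients of `χ_A` have
  -- lower limit at least its variation; Fatou's lemma in `t` then gives the bound.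
  · set s : ℕ → ℝ := fun k => 1 / ((k : ℝ) + 1) with hs
    have hspos : ∀ k, 0 < s k := fun k => by positivity
    have hslim : Tendsto s atTop (𝓝 0) := tendsto_one_div_add_atTop_nhds_zero_nat
    have h1 : ∀ k, (∫⁻ t in Set.Ioi (0 : ℝ), ENNReal.ofReal (Real.exp (-t)) *
        ENNReal.ofReal (t ^ m) * (diffMass (fun x => (charFn A x).toReal) ((t⁻¹ * s k) • u) /
          ENNReal.ofReal (t⁻¹ * s k))) ≤ dirVariation (expNeg g) u := by
      intro k
      have h2 := diffMass_le_dirVariation hF u (hspos k)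
      have hsk : ENNReal.ofReal (s k) ≠ 0 := by simpa using hspos k
      rw [← ENNReal.inv_mul_le_iff hsk ENNReal.ofReal_ne_top, h.diffMass_eq,
        ← lintegral_const_mul' _ _ (ENNReal.inv_ne_top.2 hsk)] at h2
      refine le_trans (le_of_eq (setLIntegral_congr_fun measurableSet_Ioi fun t ht => ?_)) h2
      have ht' : (0 : ℝ) < t := ht
      simp only [smul_smul]
      have h3 : ENNReal.ofReal (t ^ m) * (ENNReal.ofReal (t⁻¹ * s k))⁻¹ =
          (ENNReal.ofReal (s k))⁻¹ * ENNReal.ofReal (t ^ (m + 1)) := by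
        rw [← ENNReal.ofReal_inv_of_pos (mul_pos (inv_pos.2 ht') (hspos k)),
          ← ENNReal.ofReal_inv_of_pos (hspos k),
          ← ENNReal.ofReal_mul (by positivity), ← ENNReal.ofReal_mul (inv_pos.2 (hspos k)).le]
        congr 1
        have := hspos k
        field_simp
        ring
      rw [div_eq_mul_inv, mul_assoc, mul_comm (diffMass _ _), ← mul_assoc (ENNReal.ofReal (t ^ m)),
        h3]
      ring
    rw [← hconst]
    refine le_trans ?_ (liminf_atTop_le_of_forall_le h1)
    refine le_trans ?_ (lintegral_liminf_le fun k => ?_)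
    · refine setLIntegral_mono_ae' measurableSet_Ioi (Eventually.of_forall fun t ht => ?_)
      have ht' : (0 : ℝ) < t := ht
      rw [ENNReal.liminf_const_mul_of_ne_top]
      refine mul_le_mul_right (dirVariation_le_liminf hχ u
        (fun k => mul_pos (inv_pos.2 ht') (hspos k)) ?_) _
      · simpa using hslim.const_mul t⁻¹
      · exact ENNReal.mul_ne_top ENNReal.ofReal_ne_top ENNReal.ofReal_ne_top
    · refine Measurable.mul (by fun_prop) (Measurable.div ?_ (by fun_prop))
      exact (measurable_diffMass hm).comp (by fun_prop)

/-! ### Pointwise gradients of Lipschitz functions. -/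

open Filter Topology in
/-- For integrable Lipschitz functions the directional variation is the integral of the absolute
value of the directional derivative. -/
theorem lintegral_enorm_fderiv_eq_dirVariation {f : E n → ℝ≥0∞} {C : NNReal}
    (hF : Integrable fun x => (f x).toReal) (hL : LipschitzWith C fun x => (f x).toReal)
    (u : E n) :
    ∫⁻ x, ‖fderiv ℝ (fun x => (f x).toReal) x u‖ₑ = dirVariation f u := by
  set F : E n → ℝ := fun x => (f x).toReal with hFdef
  have hd : ∀ᵐ x : E n, DifferentiableAt ℝ F x := hL.ae_differentiableAt
  refine le_antisymm ?_ (dirVariation_le_iff.2 fun φ h1 h2 h3 => ?_)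
  · set s : ℕ → ℝ := fun k => 1 / ((k : ℝ) + 1) with hs
    have hspos : ∀ k, 0 < s k := fun k => by positivity
    have hslim : Tendsto s atTop (𝓝 0) := tendsto_one_div_add_atTop_nhds_zero_nat
    have hc : Continuous F := hL.continuous
    have e1 : ∀ k, ∫⁻ x, ‖(s k)⁻¹ • (F (x + s k • u) - F x)‖ₑ ≤ dirVariation f u := fun k => by
      have h4 := diffMass_le_dirVariation hF u (hspos k)
      have hsk : ENNReal.ofReal (s k) ≠ 0 := by simpa using hspos k
      simp only [enorm_smul]
      rw [lintegral_const_mul' _ _ (by simp), Real.enorm_eq_ofReal (inv_pos.2 (hspos k)).le,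
        ENNReal.ofReal_inv_of_pos (hspos k)]
      exact (ENNReal.inv_mul_le_iff hsk ENNReal.ofReal_ne_top).2 h4
    refine le_trans ?_ (liminf_atTop_le_of_forall_le e1)
    -- By Rademacher's theorem the quotients converge almost everywhere to the directional
    -- derivative, so Fatou's lemma applies.
    refine le_trans (le_of_eq (lintegral_congr_ae ?_)) (lintegral_liminf_le fun k => ?_)
    · filter_upwards [hd] with x hx
      have e2 := (hx.hasFDerivAt.hasLineDerivAt u).tendsto_slope_zero_right.comp
        (tendsto_nhdsWithin_iff.2 ⟨hslim, Eventually.of_forall hspos⟩)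
      exact ((continuous_enorm.tendsto _).comp e2).liminf_eq.symm
    · have : Continuous fun x => (s k)⁻¹ • (F (x + s k • u) - F x) := by fun_prop
      exact this.measurable.enorm
  · obtain ⟨D, hD⟩ := h1.lipschitzWith_of_hasCompactSupport h2 one_ne_zero
    -- The direction `-u` absorbs the sign of the integration by parts.
    have e1 := hL.integral_lineDeriv_mul_eq (μ := volume) hD h2 (-u)
    have e2 : ∫ x, F x * fderiv ℝ φ x u = ∫ x, lineDeriv ℝ F x (-u) * φ x := by
      rw [e1, neg_neg]
      refine integral_congr_ae (Eventually.of_forall fun x => ?_)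
      simp only [(h1.differentiable one_ne_zero x).lineDeriv_eq_fderiv, mul_comm]
    rw [e2]
    refine (ENNReal.ofReal_le_ofReal (le_abs_self _)).trans ?_
    rw [← Real.enorm_eq_ofReal_abs]
    refine (enorm_integral_le_lintegral_enorm _).trans (lintegral_mono_ae ?_)
    filter_upwards [hd] with x hx
    rw [hx.lineDeriv_eq_fderiv, map_neg, enorm_mul, enorm_neg]
    refine mul_le_of_le_one_right' ?_
    rw [Real.enorm_eq_ofReal_abs]
    exact ENNReal.ofReal_le_one.2 (h3 x)

theorem gaugeInf_eq_gauge {K : Set (E n)} (hconv : Convex ℝ K) (hcl : IsClosed K)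
    (h0 : (0 : E n) ∈ interior K) (x : E n) : gaugeInf K x = (gauge K x : EReal) := by
  have hK0 : K ∈ nhds (0 : E n) := mem_interior_iff_mem_nhds.1 h0
  have key : ∀ t : ℝ, 0 < t → (gaugeInf K x ≤ (t : EReal) ↔ gauge K x ≤ t) := fun t ht => by
    have h1 := gauge_le_one_iff_mem_closure (x := t⁻¹ • x) hconv hK0
    rw [hcl.closure_eq, gauge_smul_of_nonneg (inv_pos.2 ht).le, smul_eq_mul,
      inv_mul_le_iff₀ ht, mul_one] at h1
    rw [gaugeInf_le_iff hconv hcl (interior_subset h0) ht, h1]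
  refine le_antisymm (EReal.le_of_forall_lt_iff_le.1 fun z hz => ?_)
    (EReal.le_of_forall_lt_iff_le.1 fun z hz => ?_)
  · have hz' : gauge K x < z := by exact_mod_cast hz
    exact (key z ((gauge_nonneg x).trans_lt hz')).2 hz'.le
  · have hz0 : (0 : ℝ) < z := by exact_mod_cast (gaugeInf_nonneg K x).trans_lt hz
    exact_mod_cast (key z hz0).1 hz.le

theorem expGauge_toReal {K : Set (E n)} (hconv : Convex ℝ K) (hcl : IsClosed K)
    (h0 : (0 : E n) ∈ interior K) (x : E n) : (expGauge K x).toReal = Real.exp (-gauge K x) := by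
  rw [expGauge, expNeg, gaugeInf_eq_gauge hconv hcl h0, ← EReal.coe_neg, EReal.exp_coe,
    ENNReal.toReal_ofReal (Real.exp_pos _).le]

theorem abs_exp_neg_sub_exp_neg_le {a b : ℝ} (ha : 0 ≤ a) (hb : 0 ≤ b) :
    |Real.exp (-a) - Real.exp (-b)| ≤ |a - b| := by
  wlog hab : a ≤ b generalizing a b with H
  · rw [abs_sub_comm, abs_sub_comm a]
    exact H hb ha (not_le.1 hab).le
  have h1 : Real.exp (-b) ≤ Real.exp (-a) := Real.exp_le_exp.2 (neg_le_neg hab)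
  rw [abs_of_nonneg (sub_nonneg.2 h1), abs_of_nonpos (sub_nonpos.2 hab), neg_sub]
  have h2 : Real.exp (-b) = Real.exp (-a) * Real.exp (a - b) := by
    rw [← Real.exp_add]; congr 1; ring
  have h3 := Real.add_one_le_exp (a - b)
  have h4 : Real.exp (-a) ≤ 1 := Real.exp_le_one_iff.2 (neg_nonpos.2 ha)
  have h5 := Real.exp_pos (-a)
  rw [h2]
  nlinarith

theorem exists_lipschitzWith_expGauge {K : Set (E n)} (hconv : Convex ℝ K) (hcl : IsClosed K)
    (h0 : (0 : E n) ∈ interior K) : ∃ C, LipschitzWith C fun x => (expGauge K x).toReal := by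
  obtain ⟨C, hC⟩ := hconv.lipschitz_gauge (mem_interior_iff_mem_nhds.1 h0)
  refine ⟨C, LipschitzWith.of_dist_le_mul fun x y => ?_⟩
  rw [expGauge_toReal hconv hcl h0, expGauge_toReal hconv hcl h0]
  exact (abs_exp_neg_sub_exp_neg_le (gauge_nonneg x) (gauge_nonneg y)).trans (hC.dist_le_mul x y)

theorem pettySupportPointwise_eq {f : E n → ℝ≥0∞} {C : NNReal}
    (hF : Integrable fun x => (f x).toReal) (hL : LipschitzWith C fun x => (f x).toReal) :
    pettySupportPointwise f = pettySupport f := by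
  funext u
  simp only [pettySupportPointwise, pettySupport, inner_gradient_left,
    lintegral_enorm_fderiv_eq_dirVariation hF hL]

/-! ### Variation of a convex body along parallel lines. -/

theorem lintegral_enorm_indicator_Icc_le {a b h : ℝ} (hh : 0 < h) :
    ∫⁻ t, ‖(Set.Icc a b).indicator (1 : ℝ → ℝ) (t + h) - (Set.Icc a b).indicator 1 t‖ₑ ≤
      2 * ENNReal.ofReal h := by
  have h1 : ∀ t, ‖(Set.Icc a b).indicator (1 : ℝ → ℝ) (t + h) - (Set.Icc a b).indicator 1 t‖ₑ ≤
      (Set.Icc (a - h) a ∪ Set.Icc (b - h) b).indicator (1 : ℝ → ℝ≥0∞) t := by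
    intro t
    by_cases ht1 : t + h ∈ Set.Icc a b <;> by_cases ht2 : t ∈ Set.Icc a b
    · simp [ht1, ht2]
    · have : t ∈ Set.Icc (a - h) a ∪ Set.Icc (b - h) b := by
        simp only [Set.mem_Icc, Set.mem_union, not_and_or, not_le] at *
        left
        constructor
        · linarith
        · rcases ht2 with h2 | h2 <;> linarith
      simp [ht1, ht2, this]
    · have : t ∈ Set.Icc (a - h) a ∪ Set.Icc (b - h) b := by
        simp only [Set.mem_Icc, Set.mem_union, not_and_or, not_le] at *
        right
        constructor
        · rcases ht1 with h2 | h2 <;> linarith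
        · linarith
      simp [ht1, ht2, this]
    · simp [ht1, ht2]
  refine (lintegral_mono h1).trans ?_
  rw [lintegral_indicator_one (measurableSet_Icc.union measurableSet_Icc)]
  refine (measure_union_le _ _).trans ?_
  rw [Real.volume_Icc, Real.volume_Icc, sub_sub_cancel, sub_sub_cancel, two_mul]

/-- For a step no longer than the interval, the zones entered and left are disjoint; taking them
half-open keeps this true when `h = b - a`. -/
theorem le_lintegral_enorm_indicator_Icc {a b h : ℝ} (hab : h ≤ b - a) :
    2 * ENNReal.ofReal h ≤
      ∫⁻ t, ‖(Set.Icc a b).indicator (1 : ℝ → ℝ) (t + h) - (Set.Icc a b).indicator 1 t‖ₑ := by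
  have h1 : ∀ t, (Set.Ico (a - h) a ∪ Set.Ioc (b - h) b).indicator (1 : ℝ → ℝ≥0∞) t ≤
      ‖(Set.Icc a b).indicator (1 : ℝ → ℝ) (t + h) - (Set.Icc a b).indicator 1 t‖ₑ := by
    intro t
    refine Set.indicator_apply_le' (fun ht => ?_) fun _ => zero_le
    rcases ht with ht | ht
    · have ht1 : t + h ∈ Set.Icc a b := ⟨by linarith [ht.1], by linarith [ht.2]⟩
      have ht2 : t ∉ Set.Icc a b := fun h2 => absurd ht.2 (not_lt.2 h2.1)
      simp [ht1, ht2]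
    · have ht1 : t + h ∉ Set.Icc a b := fun h2 => by linarith [ht.1, h2.2]
      have ht2 : t ∈ Set.Icc a b := ⟨by linarith [ht.1], ht.2⟩
      simp [ht1, ht2]
  refine le_trans (le_of_eq ?_) (lintegral_mono h1)
  have hd : Disjoint (Set.Ico (a - h) a) (Set.Ioc (b - h) b) :=
    Set.disjoint_left.2 fun t h2 h3 => by linarith [h2.2, h3.1]
  rw [lintegral_indicator_one (measurableSet_Ico.union measurableSet_Ioc),
    measure_union hd measurableSet_Ioc, Real.volume_Ico, Real.volume_Ioc, sub_sub_cancel,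
    sub_sub_cancel, two_mul]

/-- The Lebesgue measure of the hyperplane `u^⊥`, normalized on an orthonormal basis. -/
noncomputable abbrev perpMeasure (u : E n) : Measure ((ℝ ∙ u)ᗮ : Submodule ℝ (E n)) :=
  (stdOrthonormalBasis ℝ ((ℝ ∙ u)ᗮ : Submodule ℝ (E n))).toBasis.addHaar

theorem inner_perp (u : E n) (p : ((ℝ ∙ u)ᗮ : Submodule ℝ (E n))) : ⟪u, (p : E n)⟫ = 0 :=
  Submodule.mem_orthogonal_singleton_iff_inner_right.1 p.2

theorem coe_orthogonalProjection_perp {u : E n} (hu : ‖u‖ = 1) (x : E n) :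
    (((ℝ ∙ u)ᗮ : Submodule ℝ (E n)).orthogonalProjectionOnto x : E n) = x - ⟪u, x⟫ • u := by
  have := Submodule.starProjection_add_starProjection_orthogonal (K := (ℝ ∙ u)) x
  rw [Submodule.starProjection_unit_singleton ℝ hu] at this
  rw [Submodule.coe_orthogonalProjectionOnto_apply, eq_sub_iff_add_eq, add_comm]
  exact this

theorem orthogonalProjection_perp_add_smul {u : E n} (hu : ‖u‖ = 1)
    (p : ((ℝ ∙ u)ᗮ : Submodule ℝ (E n))) (t : ℝ) :
    ((ℝ ∙ u)ᗮ : Submodule ℝ (E n)).orthogonalProjectionOnto ((p : E n) + t • u) = p := by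
  apply Subtype.ext
  rw [coe_orthogonalProjection_perp hu, inner_add_right, inner_perp, real_inner_smul_right,
    real_inner_self_eq_norm_sq, hu]
  simp

/-- The decomposition of space into lines parallel to the unit vector `u`. -/
noncomputable def lineEquiv {u : E n} (hu : ‖u‖ = 1) :
    (((ℝ ∙ u)ᗮ : Submodule ℝ (E n)) × ℝ) ≃L[ℝ] E n :=
  LinearEquiv.toContinuousLinearEquiv
    { toFun := fun q => (q.1 : E n) + q.2 • u
      invFun := fun x => (((ℝ ∙ u)ᗮ : Submodule ℝ (E n)).orthogonalProjectionOnto x, ⟪u, x⟫)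
      map_add' := fun q r => by simp [add_smul]; abel
      map_smul' := fun c q => by simp [mul_smul]
      left_inv := fun q => by
        refine Prod.ext (orthogonalProjection_perp_add_smul hu q.1 q.2) ?_
        simp only [inner_add_right, inner_perp, real_inner_smul_right,
          real_inner_self_eq_norm_sq, hu]
        simp
      right_inv := fun x => by
        simp only [coe_orthogonalProjection_perp hu, sub_add_cancel] }

theorem lineEquiv_apply {u : E n} (hu : ‖u‖ = 1) (q : ((ℝ ∙ u)ᗮ : Submodule ℝ (E n)) × ℝ) :
    lineEquiv hu q = (q.1 : E n) + q.2 • u := rfl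

theorem map_lineEquiv {u : E n} (hu : ‖u‖ = 1) :
    ((perpMeasure u).prod volume).map (lineEquiv hu) = volume := by
  let b := stdOrthonormalBasis ℝ ((ℝ ∙ u)ᗮ : Submodule ℝ (E n))
  let c := OrthonormalBasis.singleton Unit ℝ
  have h1 : (perpMeasure u).prod (volume : Measure ℝ) = (b.toBasis.prod c.toBasis).addHaar := by
    rw [Module.Basis.prod_addHaar, OrthonormalBasis.addHaar_eq_volume c]
  rw [h1, Module.Basis.map_addHaar]
  -- An orthonormal basis of `u^⊥` together with `u` is orthonormal in the whole space, so the
  -- product measure is carried to Lebesgue measure.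
  have horth : Orthonormal ℝ ((b.toBasis.prod c.toBasis).map (lineEquiv hu).toLinearEquiv) := by
    have hb := b.orthonormal
    rw [orthonormal_iff_ite] at hb ⊢
    rintro (i | i) (j | j)
    · have := hb i j
      simpa [lineEquiv_apply] using this
    · simp [lineEquiv_apply, c, real_inner_comm u, inner_perp]
    · simp [lineEquiv_apply, c, inner_perp]
    · simp [lineEquiv_apply, c, hu]
  have := (((b.toBasis.prod c.toBasis).map (lineEquiv hu).toLinearEquiv).toOrthonormalBasis
    horth).addHaar_eq_volume
  simpa using this

theorem lintegral_eq_lintegral_lines {u : E n} (hu : ‖u‖ = 1) {f : E n → ℝ≥0∞}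
    (hf : Measurable f) :
    ∫⁻ x, f x = ∫⁻ p, ∫⁻ t : ℝ, f ((p : E n) + t • u) ∂volume ∂(perpMeasure u) := by
  rw [← map_lineEquiv hu, lintegral_map hf (lineEquiv hu).continuous.measurable, lintegral_prod]
  · rfl
  · exact (hf.comp (lineEquiv hu).continuous.measurable).aemeasurable

/-- The section of `K` by the line through `p` parallel to `u`. -/
def lineSection (K : Set (E n)) (u p : E n) : Set ℝ := {t | p + t • u ∈ K}

theorem diffMass_charFn_eq {K : Set (E n)} (hK : MeasurableSet K) {u : E n} (hu : ‖u‖ = 1)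
    (h : ℝ) :
    diffMass (fun x => (charFn K x).toReal) (h • u) = ∫⁻ p, (∫⁻ t : ℝ,
      ‖(lineSection K u (p : E n)).indicator (1 : ℝ → ℝ) (t + h) -
        (lineSection K u (p : E n)).indicator 1 t‖ₑ) ∂(perpMeasure u) := by
  have hm : Measurable fun x => (charFn K x).toReal := (measurable_charFn hK).ennreal_toReal
  have hm2 : Measurable fun x => ‖(charFn K (x + h • u)).toReal - (charFn K x).toReal‖ₑ :=
    ((hm.comp (measurable_add_const (h • u))).sub hm).enorm
  rw [diffMass, lintegral_eq_lintegral_lines hu hm2]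
  refine lintegral_congr fun p => lintegral_congr fun t => ?_
  have e : ∀ s : ℝ, (charFn K ((p : E n) + s • u)).toReal =
      (lineSection K u (p : E n)).indicator (1 : ℝ → ℝ) s := fun s => by
    by_cases hs : (p : E n) + s • u ∈ K
    · have : s ∈ lineSection K u (p : E n) := hs
      simp [charFn, hs, this]
    · have : s ∉ lineSection K u (p : E n) := hs
      simp [charFn, hs, this]
  rw [← e, ← e, add_smul, ← add_assoc]

theorem lineSection_eq_Icc {K : Set (E n)} (hK : IsConvexBody K) {u : E n} (hu : ‖u‖ = 1)
    {p : E n} (hne : (lineSection K u p).Nonempty) :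
    ∃ a b, lineSection K u p = Set.Icc a b := by
  have hconv : Convex ℝ (lineSection K u p) := by
    have h1 : lineSection K u p = (AffineMap.lineMap p (p + u) : ℝ →ᵃ[ℝ] E n) ⁻¹' K := by
      ext t; simp [lineSection, AffineMap.lineMap_apply, add_comm]
    rw [h1]
    exact hK.convex.affine_preimage _
  have hcl : IsClosed (lineSection K u p) :=
    hK.isCompact.isClosed.preimage (by fun_prop : Continuous fun t : ℝ => p + t • u)
  have hbd : Bornology.IsBounded (lineSection K u p) := by
    obtain ⟨R, hR⟩ := hK.isCompact.isBounded.exists_norm_le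
    refine isBounded_iff_forall_norm_le.2 ⟨R + ‖p‖, fun t ht => ?_⟩
    have h2 := hR _ ht
    have h3 : ‖t • u‖ ≤ ‖p + t • u‖ + ‖p‖ := by
      simpa using norm_sub_le (p + t • u) p
    rw [norm_smul, hu, mul_one] at h3
    linarith
  exact ⟨_, _, eq_Icc_of_connected_compact ⟨hne, hconv.isPreconnected⟩
    (Metric.isCompact_of_isClosed_isBounded hcl hbd)⟩

theorem mem_projection_iff {K : Set (E n)} {u : E n} (hu : ‖u‖ = 1)
    (p : ((ℝ ∙ u)ᗮ : Submodule ℝ (E n))) :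
    p ∈ ((ℝ ∙ u)ᗮ : Submodule ℝ (E n)).orthogonalProjectionOnto '' K ↔
      (lineSection K u (p : E n)).Nonempty := by
  constructor
  · rintro ⟨x, hx, rfl⟩
    refine ⟨⟪u, x⟫, ?_⟩
    simpa [lineSection, coe_orthogonalProjection_perp hu] using hx
  · rintro ⟨t, ht⟩
    exact ⟨_, ht, orthogonalProjection_perp_add_smul hu p t⟩

theorem projVol_lt_top {K : Set (E n)} (hK : IsConvexBody K) (u : E n) : projVol K u < ⊤ :=
  (hK.isCompact.image (ContinuousLinearMap.continuous _)).measure_lt_top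

/-- Lines missing `K` contribute nothing, and every other line at most `2h`, for each step `h`. -/
theorem dirVariation_charFn_le {K : Set (E n)} (hK : IsConvexBody K) {u : E n} (hu : ‖u‖ = 1) :
    dirVariation (charFn K) u ≤ 2 * projVol K u := by
  have hmeas := hK.isCompact.isClosed.measurableSet
  refine dirVariation_le_of_diffMass_le
    (integrable_charFn hmeas hK.isCompact.measure_lt_top.ne) u fun h hh => ?_
  have hP : MeasurableSet (((ℝ ∙ u)ᗮ : Submodule ℝ (E n)).orthogonalProjectionOnto '' K) :=
    (hK.isCompact.image (ContinuousLinearMap.continuous _)).isClosed.measurableSet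
  rw [diffMass_charFn_eq hmeas hu]
  have h1 : ∀ p : ((ℝ ∙ u)ᗮ : Submodule ℝ (E n)), (∫⁻ t : ℝ,
      ‖(lineSection K u (p : E n)).indicator (1 : ℝ → ℝ) (t + h) -
        (lineSection K u (p : E n)).indicator 1 t‖ₑ) ≤
      (((ℝ ∙ u)ᗮ : Submodule ℝ (E n)).orthogonalProjectionOnto '' K).indicator
        (fun _ => 2 * ENNReal.ofReal h) p := by
    intro p
    by_cases hp : p ∈ ((ℝ ∙ u)ᗮ : Submodule ℝ (E n)).orthogonalProjectionOnto '' K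
    · rw [Set.indicator_of_mem hp]
      obtain ⟨a, b, hab⟩ := lineSection_eq_Icc hK hu ((mem_projection_iff hu p).1 hp)
      rw [hab]
      exact lintegral_enorm_indicator_Icc_le hh
    · have : lineSection K u (p : E n) = ∅ :=
        Set.not_nonempty_iff_eq_empty.1 fun hne => hp ((mem_projection_iff hu p).2 hne)
      simp [this]
  refine (lintegral_mono h1).trans (le_of_eq ?_)
  rw [lintegral_indicator_const hP, projVol]
  ring

/-- `K` is the closure of its interior and the boundary of a convex set is null. Hence almost every
line meeting `K` meets its interior, which excludes degenerate sections from the lower bound. -/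
theorem perpMeasure_projection_interior {K : Set (E n)} (hK : IsConvexBody K) (u : E n) :
    projVol K u ≤ perpMeasure u
      (((ℝ ∙ u)ᗮ : Submodule ℝ (E n)).orthogonalProjectionOnto '' interior K) := by
  set P := ((ℝ ∙ u)ᗮ : Submodule ℝ (E n)).orthogonalProjectionOnto with hP
  have hconv : Convex ℝ (P '' interior K) := hK.convex.interior.linear_image P.toLinearMap
  have hsub : P '' K ⊆ closure (P '' interior K) := by
    refine le_trans (Set.image_mono ?_) (image_closure_subset_closure_image P.continuous)
    rw [hK.convex.closure_interior_eq_closure_of_nonempty_interior hK.nonempty_interior]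
    exact subset_closure
  calc projVol K u ≤ perpMeasure u (closure (P '' interior K)) := measure_mono hsub
    _ = perpMeasure u (P '' interior K ∪ frontier (P '' interior K)) := by
      rw [closure_eq_self_union_frontier]
    _ ≤ perpMeasure u (P '' interior K) + perpMeasure u (frontier (P '' interior K)) :=
      measure_union_le _ _
    _ = _ := by rw [hconv.addHaar_frontier (perpMeasure u), add_zero]

-- Over the projection of the interior each section has positive length, so its quotient is at least
-- `2` for all small steps. How small depends on the line, hence Fatou's lemma.
open Filter Topology in
theorem le_dirVariation_charFn {K : Set (E n)} (hK : IsConvexBody K) {u : E n} (hu : ‖u‖ = 1) :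
    2 * projVol K u ≤ dirVariation (charFn K) u := by
  have hmeas := hK.isCompact.isClosed.measurableSet
  set P := ((ℝ ∙ u)ᗮ : Submodule ℝ (E n)).orthogonalProjectionOnto with hP
  have hopen : IsOpen (P '' interior K) :=
    P.isOpenMap (fun p => ⟨p, by simp [hP]⟩) _ isOpen_interior
  set s : ℕ → ℝ := fun k => 1 / ((k : ℝ) + 1) with hs
  have hspos : ∀ k, 0 < s k := fun k => by positivity
  have hslim : Tendsto s atTop (𝓝 0) := tendsto_one_div_add_atTop_nhds_zero_nat
  have h1 : ∀ k, (∫⁻ p, (ENNReal.ofReal (s k))⁻¹ * (∫⁻ t : ℝ,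
      ‖(lineSection K u (p : E n)).indicator (1 : ℝ → ℝ) (t + s k) -
        (lineSection K u (p : E n)).indicator 1 t‖ₑ) ∂(perpMeasure u)) ≤
      dirVariation (charFn K) u := fun k => by
    have hsk : ENNReal.ofReal (s k) ≠ 0 := by simpa using hspos k
    rw [lintegral_const_mul' _ _ (ENNReal.inv_ne_top.2 hsk), ← diffMass_charFn_eq hmeas hu,
      ENNReal.inv_mul_le_iff hsk ENNReal.ofReal_ne_top]
    exact diffMass_le_dirVariation
      (integrable_charFn hmeas hK.isCompact.measure_lt_top.ne) u (hspos k)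
  refine le_trans ?_ (liminf_atTop_le_of_forall_le h1)
  refine le_trans ?_ (lintegral_liminf_le fun k => ?_)
  · refine le_trans (mul_le_mul_right (perpMeasure_projection_interior hK u) 2) ?_
    rw [← lintegral_indicator_const hopen.measurableSet]
    refine lintegral_mono fun p => Set.indicator_apply_le' (fun hp => ?_) fun _ => zero_le
    obtain ⟨x, hx, rfl⟩ := hp
    have hcont : Continuous fun t : ℝ => ((P x : (ℝ ∙ u)ᗮ) : E n) + t • u := by fun_prop
    have hx' : ((P x : (ℝ ∙ u)ᗮ) : E n) + ⟪u, x⟫ • u ∈ interior K := by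
      simpa [hP, coe_orthogonalProjection_perp hu] using hx
    obtain ⟨a, b, hab⟩ := lineSection_eq_Icc hK hu (p := (P x : E n))
      ⟨⟪u, x⟫, Set.mem_ofPred.2 (interior_subset hx')⟩
    have hint : ⟪u, x⟫ ∈ interior (Set.Icc a b) := by
      rw [← hab]
      exact interior_mono (Set.preimage_mono interior_subset)
        ((isOpen_interior.preimage hcont).interior_eq.symm ▸ hx')
    rw [interior_Icc] at hint
    have hlt : 0 < b - a := sub_pos.2 (hint.1.trans hint.2)
    refine le_liminf_of_le (by isBoundedDefault) ?_
    filter_upwards [hslim.eventually (gt_mem_nhds hlt)] with k hk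
    rw [hab]
    have hsk : ENNReal.ofReal (s k) ≠ 0 := by simpa using hspos k
    have h2 := le_lintegral_enorm_indicator_Icc hk.le
    rwa [mul_comm, ← div_eq_mul_inv, ENNReal.le_div_iff_mul_le (Or.inl hsk)
      (Or.inl ENNReal.ofReal_ne_top)]
  · refine Measurable.const_mul ?_ _
    -- Joint measurability in the line and the position on it, as needed for measurability of the
    -- inner integral.
    set χ : ((ℝ ∙ u)ᗮ : Submodule ℝ (E n)) × ℝ → ℝ := (lineEquiv hu ⁻¹' K).indicator 1
    have hm : Measurable χ :=
      measurable_one.indicator ((lineEquiv hu).continuous.measurable hmeas)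
    have hm2 : Measurable fun q : ((ℝ ∙ u)ᗮ : Submodule ℝ (E n)) × ℝ =>
        ‖χ (q.1, q.2 + s k) -
          χ (q.1, q.2)‖ₑ :=
      ((hm.comp (by fun_prop)).sub (hm.comp (by fun_prop))).enorm
    exact hm2.lintegral_prod_right'

/-- The variation of the characteristic function of a convex body in a unit direction. -/
theorem dirVariation_charFn {K : Set (E n)} (hK : IsConvexBody K) {u : E n} (hu : ‖u‖ = 1) :
    dirVariation (charFn K) u = 2 * projVol K u :=
  le_antisymm (dirVariation_charFn_le hK hu) (le_dirVariation_charFn hK hu)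

/-! ### Sublinearity of the variation and the projection body. -/

theorem dirVariation_add_le {f : E n → ℝ≥0∞} (hF : Integrable fun x => (f x).toReal)
    (u v : E n) : dirVariation f (u + v) ≤ dirVariation f u + dirVariation f v := by
  refine dirVariation_le_iff.2 fun φ h1 h2 h3 => ?_
  have hint : ∀ w, Integrable fun x => (f x).toReal * fderiv ℝ φ x w := fun w => by
    obtain ⟨C, hC⟩ := exists_fderiv_bound h1 h2 w
    exact hF.mul_bdd (c := C) (continuous_fderiv_apply_const h1 w).aestronglyMeasurable
      (Filter.Eventually.of_forall hC)
  simp only [map_add, mul_add]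
  rw [integral_add (hint u) (hint v)]
  exact ENNReal.ofReal_add_le.trans
    (add_le_add (le_dirVariation f u h1 h2 h3) (le_dirVariation f v h1 h2 h3))

theorem dirVariation_smul (f : E n → ℝ≥0∞) {c : ℝ} (hc : 0 ≤ c) (u : E n) :
    dirVariation f (c • u) = ENNReal.ofReal c * dirVariation f u := by
  have e : ∀ φ : E n → ℝ, ENNReal.ofReal (∫ x, (f x).toReal * fderiv ℝ φ x (c • u)) =
      ENNReal.ofReal c * ENNReal.ofReal (∫ x, (f x).toReal * fderiv ℝ φ x u) := fun φ => by
    rw [← ENNReal.ofReal_mul hc, ← integral_const_mul]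
    congr 2
    funext x
    rw [map_smul, smul_eq_mul]
    ring
  simp only [dirVariation, e, ENNReal.mul_iSup]

theorem dirVariation_charFn_ne_top {K : Set (E n)} (hK : IsConvexBody K) (u : E n) :
    dirVariation (charFn K) u ≠ ⊤ := by
  rcases eq_or_ne u 0 with rfl | hu
  · simpa using dirVariation_smul (charFn K) le_rfl (0 : E n) |>.trans_ne (by simp)
  · have h1 : u = ‖u‖ • (‖u‖⁻¹ • u) := by
      rw [smul_smul, mul_inv_cancel₀ (norm_ne_zero_iff.2 hu), one_smul]
    have hu1 : ‖‖u‖⁻¹ • u‖ = 1 := norm_smul_inv_norm hu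
    rw [h1, dirVariation_smul _ (norm_nonneg u), dirVariation_charFn hK hu1]
    exact ENNReal.mul_ne_top ENNReal.ofReal_ne_top
      (ENNReal.mul_ne_top (by simp) (projVol_lt_top hK _).ne)

/-- Half of the variation of the characteristic function, as a real number. -/
noncomputable def halfVariation (K : Set (E n)) (u : E n) : ℝ :=
  (dirVariation (charFn K) u / 2).toReal

theorem coe_halfVariation {K : Set (E n)} (hK : IsConvexBody K) (u : E n) :
    ((halfVariation K u : ℝ) : EReal) = pettySupport (charFn K) u :=
  EReal.coe_ennreal_toReal (ENNReal.div_ne_top (dirVariation_charFn_ne_top hK u) (by simp))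

theorem pettySupport_charFn_of_norm_eq_one {K : Set (E n)} (hK : IsConvexBody K) {u : E n}
    (hu : ‖u‖ = 1) : pettySupport (charFn K) u = (projVol K u : EReal) := by
  rw [pettySupport, dirVariation_charFn hK hu, mul_comm, ENNReal.mul_div_cancel_right (by simp) (by simp)]

theorem halfVariation_nonneg (K : Set (E n)) (u : E n) : 0 ≤ halfVariation K u :=
  ENNReal.toReal_nonneg

theorem halfVariation_smul (K : Set (E n)) {c : ℝ} (hc : 0 ≤ c) (u : E n) :
    halfVariation K (c • u) = c * halfVariation K u := by
  rw [halfVariation, dirVariation_smul _ hc, mul_div_assoc, ENNReal.toReal_mul,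
    ENNReal.toReal_ofReal hc, halfVariation]

theorem halfVariation_add_le {K : Set (E n)} (hK : IsConvexBody K) (u v : E n) :
    halfVariation K (u + v) ≤ halfVariation K u + halfVariation K v := by
  have hne : ∀ w, dirVariation (charFn K) w / 2 ≠ ⊤ := fun w =>
    ENNReal.div_ne_top (dirVariation_charFn_ne_top hK w) (by simp)
  rw [halfVariation, halfVariation, halfVariation, ← ENNReal.toReal_add (hne u) (hne v),
    ← ENNReal.add_div]
  refine ENNReal.toReal_mono ?_ (ENNReal.div_le_div_right (dirVariation_add_le
    (integrable_charFn hK.isCompact.isClosed.measurableSet hK.isCompact.measure_lt_top.ne) u v) _)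
  rw [ENNReal.add_div]
  exact ENNReal.add_ne_top.2 ⟨hne u, hne v⟩

/-- Homogeneity extends the constraints from unit vectors to all vectors, which puts `Π K` in the
form needed for Hahn-Banach. -/
theorem mem_projBody_iff {K : Set (E n)} (hK : IsConvexBody K) {x : E n} :
    x ∈ projBody K ↔ ∀ u, ⟪x, u⟫ ≤ halfVariation K u := by
  have key : ∀ u : E n, ‖u‖ = 1 →
      ((((⟪x, u⟫ : ℝ) : EReal) ≤ (projVol K u : EReal)) ↔ ⟪x, u⟫ ≤ halfVariation K u) :=
    fun u hu => by
      rw [← pettySupport_charFn_of_norm_eq_one hK hu, ← coe_halfVariation hK,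
        EReal.coe_le_coe_iff]
  refine ⟨fun h u => ?_, fun h u hu => (key u hu).2 (h u)⟩
  rcases eq_or_ne u 0 with rfl | hu
  · simpa using halfVariation_nonneg K 0
  · have h1 : u = ‖u‖ • (‖u‖⁻¹ • u) := by
      rw [smul_smul, mul_inv_cancel₀ (norm_ne_zero_iff.2 hu), one_smul]
    have hu1 : ‖‖u‖⁻¹ • u‖ = 1 := norm_smul_inv_norm hu
    rw [h1, halfVariation_smul K (norm_nonneg u), real_inner_smul_right]
    exact mul_le_mul_of_nonneg_left ((key _ hu1).1 (h _ hu1)) (norm_nonneg u)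

theorem zero_mem_projBody {K : Set (E n)} (hK : IsConvexBody K) : (0 : E n) ∈ projBody K :=
  (mem_projBody_iff hK).2 fun u => by simpa using halfVariation_nonneg K u

theorem projBody_eq_iInter {K : Set (E n)} (hK : IsConvexBody K) :
    projBody K = ⋂ u, {x : E n | ⟪x, u⟫ ≤ halfVariation K u} := by
  ext x
  simp [mem_projBody_iff hK]

theorem convex_projBody {K : Set (E n)} (hK : IsConvexBody K) : Convex ℝ (projBody K) := by
  rw [projBody_eq_iInter hK]
  refine convex_iInter fun u => ?_
  have := convex_halfSpace_le (𝕜 := ℝ) (f := fun x : E n => ⟪x, u⟫)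
    ⟨fun x y => inner_add_left x y u, fun c x => by simp [real_inner_smul_left]⟩ (halfVariation K u)
  exact this

theorem isClosed_projBody {K : Set (E n)} (hK : IsConvexBody K) : IsClosed (projBody K) := by
  rw [projBody_eq_iInter hK]
  exact isClosed_iInter fun u => isClosed_le (by fun_prop) continuous_const

theorem isBounded_projBody {K : Set (E n)} (hK : IsConvexBody K) :
    Bornology.IsBounded (projBody K) := by
  let b := EuclideanSpace.basisFun (Fin n) ℝ
  refine isBounded_iff_forall_norm_le.2
    ⟨∑ i, max (halfVariation K (b i)) (halfVariation K (-b i)), fun x hx => ?_⟩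
  have hx' := (mem_projBody_iff hK).1 hx
  calc ‖x‖ = ‖∑ i, ⟪b i, x⟫ • b i‖ := by rw [b.sum_repr']
    _ ≤ ∑ i, ‖⟪b i, x⟫ • b i‖ := norm_sum_le _ _
    _ ≤ _ := Finset.sum_le_sum fun i _ => ?_
  rw [norm_smul, b.norm_eq_one, mul_one, Real.norm_eq_abs, real_inner_comm]
  refine abs_le'.2 ⟨(hx' _).trans (le_max_left _ _), ?_⟩
  rw [← inner_neg_right]
  exact (hx' _).trans (le_max_right _ _)

/-- The variation of a convex body is bounded from below uniformly in the direction. -/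
theorem exists_pos_le_halfVariation {K : Set (E n)} (hK : IsConvexBody K) :
    ∃ c : ℝ, 0 < c ∧ ∀ u : E n, ‖u‖ = 1 → c ≤ halfVariation K u := by
  obtain ⟨R, hR⟩ := hK.isCompact.isBounded.exists_norm_le
  obtain ⟨x₀, hx₀⟩ := hK.nonempty_interior
  have hR0 : 0 ≤ R := (norm_nonneg _).trans (hR x₀ (interior_subset hx₀))
  have hmeas := hK.isCompact.isClosed.measurableSet
  have hfin : volume K ≠ ⊤ := hK.isCompact.measure_lt_top.ne
  have hvol : 0 < (volume K).toReal :=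
    ENNReal.toReal_pos (Measure.measure_pos_of_nonempty_interior _ hK.nonempty_interior).ne' hfin
  -- A step longer than the diameter of `K`: the translate is disjoint from `K`, so the
  -- `L¹`-distance is at least `vol(K)`.
  set h : ℝ := 2 * R + 1
  have hh : 0 < h := by positivity
  refine ⟨(volume K).toReal / (2 * h), by positivity, fun u hu => ?_⟩
  have h1 : volume K ≤ ENNReal.ofReal h * dirVariation (charFn K) u := by
    refine le_trans ?_ (diffMass_le_dirVariation (integrable_charFn hmeas hfin) u hh)
    rw [← lintegral_indicator_one hmeas]
    refine lintegral_mono fun x => Set.indicator_apply_le' (fun hx => ?_) fun _ => zero_le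
    have hx2 : x + h • u ∉ K := fun hx2 => by
      have h3 : ‖h • u‖ ≤ ‖x + h • u‖ + ‖x‖ := by simpa using norm_sub_le (x + h • u) x
      rw [norm_smul, hu, mul_one, Real.norm_of_nonneg hh.le] at h3
      linarith [hR _ hx, hR _ hx2, show h = 2 * R + 1 from rfl]
    simp [charFn, hx, hx2]
  have h2 := ENNReal.toReal_mono
    (ENNReal.mul_ne_top ENNReal.ofReal_ne_top (dirVariation_charFn_ne_top hK u)) h1
  rw [ENNReal.toReal_mul, ENNReal.toReal_ofReal hh.le] at h2
  rw [halfVariation, ENNReal.toReal_div, ENNReal.toReal_ofNat, div_le_div_iff₀ (by positivity) two_pos]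
  linarith

theorem nonempty_interior_projBody {K : Set (E n)} (hK : IsConvexBody K) :
    (interior (projBody K)).Nonempty := by
  obtain ⟨c, hc, hcu⟩ := exists_pos_le_halfVariation hK
  refine ⟨0, mem_interior_iff_mem_nhds.2 (Metric.mem_nhds_iff.2 ⟨c, hc, fun x hx u hu => ?_⟩)⟩
  rw [← pettySupport_charFn_of_norm_eq_one hK hu, ← coe_halfVariation hK, EReal.coe_le_coe_iff]
  have h1 := real_inner_le_norm x u
  rw [hu, mul_one] at h1
  exact h1.trans ((mem_ball_zero_iff.1 hx).le.trans (hcu u hu))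

theorem isConvexBody_projBody {K : Set (E n)} (hK : IsConvexBody K) :
    IsConvexBody (projBody K) :=
  ⟨convex_projBody hK, Metric.isCompact_of_isClosed_isBounded (isClosed_projBody hK)
    (isBounded_projBody hK), nonempty_interior_projBody hK⟩

/-- Every direction has a supporting point of the projection body. -/
theorem exists_mem_projBody_inner_eq {K : Set (E n)} (hK : IsConvexBody K) (u : E n) :
    ∃ x ∈ projBody K, ⟪x, u⟫ = halfVariation K u := by
  rcases eq_or_ne u 0 with rfl | hu
  · refine ⟨0, zero_mem_projBody hK, ?_⟩
    have := halfVariation_smul K le_rfl (0 : E n)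
    simpa using this.symm
  -- The functional `c u ↦ c * halfVariation K u` on the line through `u` is dominated by
  -- `halfVariation K`: with equality for `c ≥ 0`, and by sign for `c < 0`. Its extension represents
  -- the supporting point.
  obtain ⟨g, hg1, hg2⟩ := exists_extension_of_le_sublinear
    (LinearPMap.mkSpanSingleton u (halfVariation K u) hu) (halfVariation K)
    (fun c hc x => halfVariation_smul K hc.le x) (halfVariation_add_le hK) (by
      rintro ⟨x, hx⟩
      obtain ⟨c, rfl⟩ := Submodule.mem_span_singleton.1 hx
      refine (LinearPMap.mkSpanSingleton'_apply (σ := RingHom.id ℝ) u _ _ c hx).trans_le ?_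
      rw [RingHom.id_apply, smul_eq_mul]
      rcases le_or_gt 0 c with hc | hc
      · exact (halfVariation_smul K hc u).ge
      · exact (mul_nonpos_of_nonpos_of_nonneg hc.le (halfVariation_nonneg K u)).trans
          (halfVariation_nonneg K _))
  let x : E n := (InnerProductSpace.toDual ℝ (E n)).symm (LinearMap.toContinuousLinearMap g)
  have hx : ∀ y, ⟪x, y⟫ = g y := fun y => by simp [x]
  refine ⟨x, (mem_projBody_iff hK).2 fun y => (hx y).trans_le (hg2 y), ?_⟩
  rw [hx]
  refine (hg1 ⟨u, Submodule.mem_span_singleton_self u⟩).trans ?_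
  exact LinearPMap.mkSpanSingleton_apply ℝ ℝ hu (halfVariation K u)

theorem pettySupport_charFn {K : Set (E n)} (hK : IsConvexBody K) :
    pettySupport (charFn K) = supportSet (projBody K) := by
  funext u
  rw [← coe_halfVariation hK]
  refine le_antisymm ?_ (supportSet_le_iff.2 fun y hy => ?_)
  · obtain ⟨x, hx, hxu⟩ := exists_mem_projBody_inner_eq hK u
    rw [← hxu, real_inner_comm]
    exact le_supportSet hx
  · rw [real_inner_comm]
    exact_mod_cast (mem_projBody_iff hK).1 hy u

theorem pettySupport_expGauge (hn : 1 ≤ n) {K : Set (E n)} (hK : IsConvexBody K)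
    (h0 : (0 : E n) ∈ K) :
    pettySupport (expGauge K) =
      fun u => ((n - 1).factorial : EReal) * supportSet (projBody K) u := by
  funext u
  rw [← pettySupport_charFn hK, pettySupport, pettySupport, expGauge,
    (isGaugeOf_gaugeInf hK.convex hK.isCompact.isClosed h0).dirVariation_expNeg hn
      hK.isCompact.measure_lt_top.ne, mul_div_assoc, EReal.coe_ennreal_mul]
  congr 1

end Petty

/-! ### Assembly of the statements. -/

theorem mainTheorem3 (n : ℕ) (hn : 1 ≤ n) (K : Set (Petty.E n)) (hK : Petty.IsConvexBody K) :
    -- the projection body is a convex body with the prescribed support function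
    (Petty.IsConvexBody (Petty.projBody K) ∧
      ∀ u : Petty.E n, ‖u‖ = 1 →
        Petty.supportSet (Petty.projBody K) u = (Petty.projVol K u : EReal)) ∧
    -- support functions of the characteristic function and of the exponential gauge
    Petty.supportFn (Petty.charFn K) = Petty.supportSet K ∧
    Petty.supportFn (Petty.expGauge K) = Petty.indicatorInf (Petty.polarSet K) ∧
    -- projection function and polar projection function of the characteristic function
    Petty.pettySupport (Petty.charFn K) = Petty.supportSet (Petty.projBody K) ∧
    Petty.supportFn (Petty.pettyFn (Petty.charFn K)) = Petty.supportSet (Petty.projBody K) ∧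
    Petty.pettyFn (Petty.charFn K) = Petty.expNeg (Petty.indicatorInf (Petty.projBody K)) ∧
    Petty.pettyFn (Petty.charFn K) = Petty.charFn (Petty.projBody K) ∧
    Petty.polarPettyFn (Petty.charFn K) = Petty.expNeg (Petty.supportSet (Petty.projBody K)) ∧
    volume K = ∫⁻ x, Petty.charFn K x ∧
    Measurable (Petty.polarPettyFn (Petty.charFn K)) ∧
    ∫⁻ x, Petty.polarPettyFn (Petty.charFn K) x =
      (n.factorial : ℝ≥0∞) * volume (Petty.polarProjBody K) ∧
    -- exponential gauges of bodies that contain the origin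
    ((0 : Petty.E n) ∈ K →
      Petty.pettySupport (Petty.expGauge K) =
        (fun u => ((n - 1).factorial : EReal) * Petty.supportSet (Petty.projBody K) u) ∧
      Petty.supportFn (Petty.pettyFn (Petty.expGauge K)) =
        (fun u => ((n - 1).factorial : EReal) * Petty.supportSet (Petty.projBody K) u) ∧
      ((0 : Petty.E n) ∈ interior K →
        (∀ᵐ x : Petty.E n, DifferentiableAt ℝ (fun z => (Petty.expGauge K z).toReal) x) ∧
        Petty.pettySupportPointwise (Petty.expGauge K) =
          (fun u => ((n - 1).factorial : EReal) * Petty.supportSet (Petty.projBody K) u)) ∧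
      Measurable (Petty.expGauge K) ∧
      ∫⁻ x, Petty.expGauge K x = (n.factorial : ℝ≥0∞) * volume K ∧
      (n.factorial : ℝ≥0∞) * volume K = (n.factorial : ℝ≥0∞) * ∫⁻ x, Petty.charFn K x ∧
      Measurable (Petty.polarPettyFn (Petty.expGauge K)) ∧
      ∫⁻ x, Petty.polarPettyFn (Petty.expGauge K) x =
        (n.factorial : ℝ≥0∞) * (ENNReal.ofReal (Real.Gamma n) ^ n)⁻¹ *
          volume (Petty.polarProjBody K) ∧
      (n.factorial : ℝ≥0∞) * (ENNReal.ofReal (Real.Gamma n) ^ n)⁻¹ *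
          volume (Petty.polarProjBody K) =
        (ENNReal.ofReal (Real.Gamma n) ^ n)⁻¹ *
          ∫⁻ x, Petty.polarPettyFn (Petty.charFn K) x) := by
  have hL := Petty.isConvexBody_projBody hK
  have h0L := Petty.zero_mem_projBody hK
  have hmeas := hK.isCompact.isClosed.measurableSet
  have hsupp := Petty.pettySupport_charFn hK
  have hneL : (Petty.projBody K).Nonempty := ⟨0, h0L⟩
  have hclL := hL.isCompact.isClosed
  have hpolar := Petty.polarPettyFn_eq_expNeg hneL hL.convex hclL hsupp
  have hvol : volume K = ∫⁻ x, Petty.charFn K x := (lintegral_indicator_one hmeas).symm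
  have hgL := Petty.isGaugeOf_supportSet h0L
  have hint : ∫⁻ x, Petty.polarPettyFn (Petty.charFn K) x =
      (n.factorial : ℝ≥0∞) * volume (Petty.polarProjBody K) := by
    rw [hpolar, hgL.lintegral_expNeg, Petty.polarProjBody]
  refine ⟨⟨hL, fun u hu => ?_⟩, Petty.supportFn_charFn K,
    Petty.supportFn_expGauge (hK.nonempty_interior.mono interior_subset), hsupp,
    Petty.supportFn_pettyFn hneL hL.convex hclL hsupp, ?_,
    Petty.pettyFn_eq_charFn hneL hL.convex hclL hsupp, hpolar, hvol, ?_, hint, fun h0 => ?_⟩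
  · rw [← hsupp, Petty.pettySupport_charFn_of_norm_eq_one hK hu]
  · rw [Petty.expNeg_indicatorInf, Petty.pettyFn_eq_charFn hneL hL.convex hclL hsupp]
  · rw [hpolar]
    exact hgL.measurable_expNeg
  set c : ℝ := ((n - 1).factorial : ℝ) with hc
  have hc0 : 0 < c := by positivity
  have hΓ : Real.Gamma n = c := by
    have := Real.Gamma_nat_eq_factorial (n - 1)
    rwa [← Nat.cast_add_one, Nat.sub_add_cancel hn] at this
  have hexp := Petty.pettySupport_expGauge hn hK h0
  -- The factor `(n-1)!` is absorbed into the body, so the duality lemmas apply to the dilate `c • Π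
  -- K`.
  have hcL : (fun u => ((n - 1).factorial : EReal) * Petty.supportSet (Petty.projBody K) u) =
      Petty.supportSet (c • Petty.projBody K) := by
    funext u
    rw [Petty.supportSet_smul_left hc0, hc]
    rfl
  have hsupp2 := hexp.trans hcL
  have hg := Petty.isGaugeOf_gaugeInf hK.convex hK.isCompact.isClosed h0
  have h0cL : (0 : Petty.E n) ∈ c • Petty.projBody K := ⟨0, h0L, smul_zero c⟩
  have hgcL := Petty.isGaugeOf_supportSet h0cL
  have hcvx : Convex ℝ (c • Petty.projBody K) := hL.convex.smul c
  have hcl : IsClosed (c • Petty.projBody K) := (hL.isCompact.smul c).isClosed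
  have hpolar2 := Petty.polarPettyFn_eq_expNeg ⟨0, h0cL⟩ hcvx hcl hsupp2
  refine ⟨hexp, ?_, fun hint0 => ?_, hg.measurable_expNeg, hg.lintegral_expNeg, by rw [hvol],
    ?_, ?_, ?_⟩
  · rw [Petty.supportFn_pettyFn ⟨0, h0cL⟩ hcvx hcl hsupp2, hcL]
  · obtain ⟨C, hC⟩ := Petty.exists_lipschitzWith_expGauge hK.convex hK.isCompact.isClosed hint0
    refine ⟨hC.ae_differentiableAt, ?_⟩
    exact (Petty.pettySupportPointwise_eq
      (hg.integrable_expNeg hK.isCompact.measure_lt_top.ne) hC).trans hexp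
  · rw [hpolar2]
    exact hgcL.measurable_expNeg
  -- The polar of `c • Π K` is `c⁻¹ • Π° K`, whose volume carries the factor `c^{-n} = Γ(n)^{-n}`.
  · rw [hpolar2, hgcL.lintegral_expNeg, Petty.polarSet_smul hc0, Measure.addHaar_smul,
      finrank_euclideanSpace_fin, hΓ, Petty.polarProjBody, mul_assoc]
    congr 2
    rw [abs_of_pos (by positivity), inv_pow, ENNReal.ofReal_inv_of_pos (by positivity),
      ENNReal.ofReal_pow hc0.le]
  · rw [hint]
    ring
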